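/- Let $(V_\ell)_{\ell>0}$ be real-valued functions on $\mathbb R^3$. Write $V_\ell^-=\max(-V_\ell,0)$, $J_\ell(x)=1$ if $V_\ell(x)\ge 0$ and $J_\ell(x)=-1$ if $V_\ell(x)<0$, $V_\ell^{1/2}=J_\ell|V_\ell|^{1/2}$, and let $p^{-2}=(-\Delta)^{-1}$ be the integral operator with kernel $\frac{1}{4\pi|x-y|}$. On $L^2(\mathbb R^3)$ put $$B_\ell=V_\ell^{1/2}\,p^{-2}\,|V_\ell|^{1/2},\qquad X_\ell^-=(V_\ell^-)^{1/2}\,p^{-2}\,(V_\ell^-)^{1/2}.$$ Below, $f=O(g)$ means $\limsup_{\ell\to0}|f(\ell)/g(\ell)|<\infty$. Assume: (A1) $V_\ell\in L^{3/2}(\mathbb R^3)\cap L^1(\mathbb R^3,(1+|x|^2)\,dx)$ for every $\ell>0$. (A2) The operators $1+B_\ell$ and $1-X_\ell^-$ have lowest eigenvalues $e_\ell\in\mathbb R$ and $e_\ell^-\in\mathbb R$, respectively; these are non-degenerate, $e_\ell\neq0$, $\lim_{\ell\to0}e_\ell=0$ and $e_\ell^-=O(e_\ell)$; and there is $c>0$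 such that, for all sufficiently small $\ell$, all other eigenvalues $\mu$ of $1+B_\ell$ and of $1-X_\ell^-$ satisfy $|\mu|\ge c$. (Equivalently, $-\Delta+\lambda V_\ell$ and $-\Delta-\lambda^-V_\ell^-$ have non-degenerate zero-energy resonances at $\lambda=(1-e_\ell)^{-1}$ and $\lambda^-=(1-e_\ell^-)^{-1}$.) (A3) $\|V_\ell\|_{L^1}=O(1)$ and $\|V_\ell^-\|_{L^1}=O(e_\ell)$. (A4) $\int|V_\ell(x)||x|^2dx=O(e_\ell^2)$ and $\int|V_\ell^-(x)||x|^2dx=O(e_\ell^3)$. Then there is a constant $C$ such that for all sufficiently small $\ell>0$ the operator $1+B_\ell$ has a bounded inverse and, for every eigenvector $\phi_\ell$ of $1+B_\ell$ to the eigenvalue $e_\ell$, one has $\langle J_\ell\phi_\ell,\phi_\ell\rangle\neq0$, and the (in general non-orthogonal) projection $$P_\ell=\frac{|\phi_\ell\rangle\langle J_\ell\phi_\ell|}{\langle J_\ell\phi_\ell,\phi_\ell\rangle}$$ satisfies $$\big\|(1+B_\ell)^{-1}(1-P_\ell)\big\|\le C\qquad\text{and}\qquad (1+B_\ell)^{-1}P_\ell=\frac1{e_\ell}P_\ell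 .$$ Thus the $1/e_\ell$ divergence of $(1+B_\ell)^{-1}$ comes only from the direction of $\phi_\ell$. -/

import Mathlib

open MeasureTheory Filter Topology Asymptotics
open scoped ENNReal

noncomputable section

namespace PointInteraction

/-- Euclidean three-space. -/
abbrev E3 : Type := EuclideanSpace ℝ (Fin 3)

/-- The Hilbert space `L²(ℝ³)` of complex-valued functions. -/
abbrev L2 : Type := Lp ℂ 2 (volume : Measure E3)

/-! ### Integral operators with square-integrable kernel -/

lemma kernel_pairing_lintegral_le (K : E3 × E3 → ℂ)
    (hK : AEStronglyMeasurable K (volume.prod volume)) (φ : L2) :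
    ∀ᵐ x, ∫⁻ y, ‖K (x, y) * φ y‖ₑ ≤
      (∫⁻ y, ‖K (x, y)‖ₑ ^ (2 : ℝ)) ^ (1 / 2 : ℝ) * eLpNorm φ 2 volume := by
  filter_upwards [hK.prodMk_left] with x hx
  have h := ENNReal.lintegral_mul_le_Lp_mul_Lq (volume : Measure E3)
    (p := 2) (q := 2) Real.HolderConjugate.two_two hx.enorm
    (Lp.aestronglyMeasurable φ).enorm
  rw [eLpNorm_eq_lintegral_rpow_enorm_toReal (by norm_num) (by norm_num)]
  simpa [Pi.mul_apply, enorm_mul] using h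

lemma kernel_slice_lt_top (K : E3 × E3 → ℂ) (hK : MemLp K 2 (volume.prod volume)) :
    ∀ᵐ x, ∫⁻ y, ‖K (x, y)‖ₑ ^ (2 : ℝ) < ∞ := by
  have h1 := hK.eLpNorm_lt_top
  rw [eLpNorm_lt_top_iff_lintegral_rpow_enorm_lt_top (by norm_num) (by norm_num)] at h1
  have hm : AEMeasurable (fun p : E3 × E3 => ‖K p‖ₑ ^ (2 : ℝ)) (volume.prod volume) :=
    hK.1.enorm.pow_const _
  simp only [ENNReal.toReal_ofNat] at h1
  rw [lintegral_prod _ hm] at h1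
  exact ae_lt_top' hm.lintegral_prod_right' h1.ne

lemma kernel_integrable (K : E3 × E3 → ℂ) (hK : MemLp K 2 (volume.prod volume)) (φ : L2) :
    ∀ᵐ x, Integrable (fun y => K (x, y) * φ y) := by
  filter_upwards [kernel_pairing_lintegral_le K hK.1 φ, kernel_slice_lt_top K hK,
    hK.1.prodMk_left] with x h1 h2 h3
  refine ⟨h3.mul (Lp.aestronglyMeasurable φ), lt_of_le_of_lt h1 ?_⟩
  exact ENNReal.mul_lt_top (ENNReal.rpow_lt_top_of_nonneg (by norm_num) h2.ne) (Lp.eLpNorm_lt_top φ)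

lemma kernel_eLpNorm_le (K : E3 × E3 → ℂ) (hK : MemLp K 2 (volume.prod volume)) (φ : L2) :
    eLpNorm (fun x => ∫ y, K (x, y) * φ y) 2 volume ≤
      eLpNorm K 2 (volume.prod volume) * eLpNorm φ 2 volume := by
  have hm : AEMeasurable (fun p : E3 × E3 => ‖K p‖ₑ ^ (2 : ℝ)) (volume.prod volume) :=
    hK.1.enorm.pow_const _
  rw [eLpNorm_eq_lintegral_rpow_enorm_toReal (by norm_num) (by norm_num),
    eLpNorm_eq_lintegral_rpow_enorm_toReal (f := K) (by norm_num) (by norm_num)]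
  simp only [ENNReal.toReal_ofNat]
  have key : ∫⁻ x, ‖∫ y, K (x, y) * φ y‖ₑ ^ (2 : ℝ) ≤
      (∫⁻ p, ‖K p‖ₑ ^ (2 : ℝ) ∂(volume.prod volume)) * (eLpNorm φ 2 volume) ^ (2 : ℝ) := by
    rw [lintegral_prod _ hm, ← lintegral_mul_const'' _ hm.lintegral_prod_right']
    refine lintegral_mono_ae ?_
    filter_upwards [kernel_pairing_lintegral_le K hK.1 φ] with x hx
    calc ‖∫ y, K (x, y) * φ y‖ₑ ^ (2 : ℝ)
        ≤ ((∫⁻ y, ‖K (x, y)‖ₑ ^ (2 : ℝ)) ^ (1 / 2 : ℝ) * eLpNorm φ 2 volume) ^ (2 : ℝ) := by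
          gcongr
          exact (enorm_integral_le_lintegral_enorm _).trans hx
      _ = _ := by
          rw [ENNReal.mul_rpow_of_nonneg _ _ (by norm_num), ← ENNReal.rpow_mul]
          norm_num
  calc (∫⁻ x, ‖∫ y, K (x, y) * φ y‖ₑ ^ (2 : ℝ)) ^ (1 / 2 : ℝ)
      ≤ ((∫⁻ p, ‖K p‖ₑ ^ (2 : ℝ) ∂(volume.prod volume)) *
          (eLpNorm φ 2 volume) ^ (2 : ℝ)) ^ (1 / 2 : ℝ) := by gcongr
    _ = _ := by
        rw [ENNReal.mul_rpow_of_nonneg _ _ (by norm_num), ← ENNReal.rpow_mul]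
        norm_num

lemma kernel_memLp (K : E3 × E3 → ℂ) (hK : MemLp K 2 (volume.prod volume)) (φ : L2) :
    MemLp (fun x => ∫ y, K (x, y) * φ y) 2 volume := by
  refine ⟨?_, lt_of_le_of_lt (kernel_eLpNorm_le K hK φ)
    (ENNReal.mul_lt_top hK.eLpNorm_lt_top (Lp.eLpNorm_lt_top φ))⟩
  exact (hK.1.mul (Lp.aestronglyMeasurable φ).comp_snd).integral_prod_right'

/-- The bounded operator `(Tφ)(x) = ∫ K(x,y) φ(y) dy` on `L²(ℝ³)`, for `K ∈ L²(ℝ³ × ℝ³)`. -/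
def kernelOp (K : E3 × E3 → ℂ) (hK : MemLp K 2 (volume.prod volume)) : L2 →L[ℂ] L2 :=
  LinearMap.mkContinuous
    { toFun := fun φ => (kernel_memLp K hK φ).toLp _
      map_add' := fun φ ψ => by
        rw [← MemLp.toLp_add]
        refine (MemLp.toLp_eq_toLp_iff _ _).2 ?_
        filter_upwards [kernel_integrable K hK φ, kernel_integrable K hK ψ] with x h1 h2
        rw [Pi.add_apply, ← integral_add h1 h2]
        refine integral_congr_ae ?_
        filter_upwards [Lp.coeFn_add φ ψ] with y hy
        rw [hy, Pi.add_apply, mul_add]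
      map_smul' := fun c φ => by
        rw [RingHom.id_apply, ← MemLp.toLp_const_smul]
        refine (MemLp.toLp_eq_toLp_iff _ _).2 (Eventually.of_forall fun x => ?_)
        rw [Pi.smul_apply, ← integral_smul]
        refine integral_congr_ae ?_
        filter_upwards [Lp.coeFn_smul c φ] with y hy
        rw [hy, Pi.smul_apply, smul_eq_mul, smul_eq_mul, mul_left_comm] }
    (eLpNorm K 2 (volume.prod volume)).toReal
    (fun φ => by
      change ‖(kernel_memLp K hK φ).toLp _‖ ≤ _
      rw [Lp.norm_toLp, Lp.norm_def, ← ENNReal.toReal_mul]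
      exact ENNReal.toReal_mono
        (ENNReal.mul_lt_top hK.eLpNorm_lt_top (Lp.eLpNorm_lt_top φ)).ne
        (kernel_eLpNorm_le K hK φ))

lemma kernelOp_apply (K : E3 × E3 → ℂ) (hK : MemLp K 2 (volume.prod volume)) (φ : L2) :
    kernelOp K hK φ =ᵐ[volume] fun x => ∫ y, K (x, y) * φ y :=
  (kernel_memLp K hK φ).coeFn_toLp

/-! ### The operators `f p⁻² g` with `f, g ∈ L³(ℝ³)` -/

/-- An auxiliary integrable radial profile. -/
def profile (r : ℝ) : ℝ := if r < 1 then (r ^ 2)⁻¹ else (r ^ 6)⁻¹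

lemma profile_nonneg (r : ℝ) : 0 ≤ profile r := by
  unfold profile; split_ifs <;> positivity

lemma measurable_profile : Measurable profile :=
  Measurable.ite measurableSet_Iio (by fun_prop) (by fun_prop)

lemma integrable_profile : Integrable (fun z : E3 => profile ‖z‖) := by
  rw [integrable_fun_norm_addHaar (volume : Measure E3) (f := profile)]
  have hd : Module.finrank ℝ E3 - 1 = 2 := by simp
  rw [hd, ← Set.Ioc_union_Ioi_eq_Ioi (zero_le_one : (0 : ℝ) ≤ 1)]
  refine IntegrableOn.union ?_ ?_
  · have : IntegrableOn (fun _ : ℝ => (1 : ℝ)) (Set.Ioc 0 1) := by simp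
    refine this.mono' ((measurable_id.pow_const 2).smul measurable_profile).aestronglyMeasurable ?_
    refine (ae_restrict_iff' measurableSet_Ioc).2 (Eventually.of_forall fun r hr => ?_)
    rw [Real.norm_eq_abs, abs_of_nonneg (smul_nonneg (by positivity) (profile_nonneg r)), smul_eq_mul]
    have hr0 := hr.1
    unfold profile
    split_ifs with h
    · rw [mul_inv_cancel₀ (by positivity)]
    · have : r = 1 := le_antisymm hr.2 (not_lt.1 h)
      simp [this]
  · have h4 : IntegrableOn (fun r : ℝ => r ^ (-4 : ℝ)) (Set.Ioi 1) :=
      integrableOn_Ioi_rpow_of_lt (by norm_num) one_pos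
    refine h4.congr_fun (fun r hr => ?_) measurableSet_Ioi
    have hr1 : (1 : ℝ) < r := hr
    have hr0 : 0 < r := by linarith
    simp only [profile, if_neg (not_lt.2 hr1.le), smul_eq_mul]
    rw [Real.rpow_neg hr0.le]
    norm_cast
    field_simp

lemma rollnik_pointwise {s t r : ℝ} (hs : 0 ≤ s) (hr : 0 ≤ r) (hst : s ≤ t) :
    (t * s / r) ^ 2 ≤ t ^ 3 * s ^ 3 + t ^ 6 * profile (t * r) := by
  have hG := profile_nonneg (t * r)
  have ht : 0 ≤ t := hs.trans hst
  rcases ht.eq_or_lt with rfl | ht0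
  · simp
  rcases hr.eq_or_lt with rfl | hr0
  · simpa using add_nonneg (mul_nonneg (pow_nonneg ht 3) (pow_nonneg hs 3))
      (mul_nonneg (pow_nonneg ht 6) hG)
  unfold profile
  split_ifs with h
  · have h1 : t ^ 6 * ((t * r) ^ 2)⁻¹ = (t * t / r) ^ 2 := by field_simp
    have h2 : (t * s / r) ^ 2 ≤ (t * t / r) ^ 2 := by gcongr
    have h3 : 0 ≤ t ^ 3 * s ^ 3 := by positivity
    linarith
  · have h1 : t ^ 6 * ((t * r) ^ 6)⁻¹ = (r ^ 6)⁻¹ := by field_simp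
    rw [h1]
    have hp : 0 ≤ (r ^ 6)⁻¹ := by positivity
    have hq : 0 ≤ t ^ 3 * s ^ 3 := by positivity
    have e1 : (t * s / r) ^ 2 = (t * s) ^ 2 * (r ^ 2)⁻¹ := by field_simp
    have e2 : (r ^ 6)⁻¹ = ((r ^ 2)⁻¹) ^ 2 * (r ^ 2)⁻¹ := by field_simp
    have e3 : t ^ 3 * s ^ 3 = (t * s) ^ 2 * (t * s) := by ring
    rcases le_total (r ^ 2)⁻¹ (t * s) with h | h
    · have : (t * s) ^ 2 * (r ^ 2)⁻¹ ≤ (t * s) ^ 2 * (t * s) := by gcongr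
      linarith
    · have : (t * s) ^ 2 * (r ^ 2)⁻¹ ≤ ((r ^ 2)⁻¹) ^ 2 * (r ^ 2)⁻¹ := by gcongr
      linarith

lemma integrable_profile_term {h : E3 → ℝ} (h0 : ∀ x, 0 ≤ h x) (hh : MemLp h 3 volume) :
    Integrable (fun p : E3 × E3 => h p.1 ^ 6 * profile (h p.1 * ‖p.1 - p.2‖))
      (volume.prod volume) := by
  have hm : AEMeasurable (fun p : E3 × E3 => h p.1) (volume.prod volume) :=
    hh.1.aemeasurable.comp_fst
  have hm2 : AEStronglyMeasurable
      (fun p : E3 × E3 => h p.1 ^ 6 * profile (h p.1 * ‖p.1 - p.2‖)) (volume.prod volume) := by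
    refine AEMeasurable.aestronglyMeasurable ((hm.pow_const 6).mul
      (measurable_profile.comp_aemeasurable (hm.mul ?_)))
    exact (measurable_fst.sub measurable_snd).norm.aemeasurable
  have hsl : ∀ x : E3, h x ≠ 0 → (fun y => profile (h x * ‖x - y‖)) =
      fun y => (fun z : E3 => profile ‖h x • z‖) (x - y) := by
    intro x hx
    funext y
    simp [norm_smul, abs_of_nonneg (h0 x)]
  have h3 : Integrable (fun x => h x ^ 3) := by
    have := hh.integrable_norm_pow (by norm_num)
    refine this.congr (Eventually.of_forall fun x => ?_)
    simp [abs_of_nonneg (h0 x)]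
  rw [integrable_prod_iff hm2]
  constructor
  · refine Eventually.of_forall fun x => ?_
    by_cases hx : h x = 0
    · simp [hx]
    · have hi : Integrable (fun y => profile (h x * ‖x - y‖)) := by
        rw [hsl x hx]
        exact Integrable.comp_sub_left (f := fun z : E3 => profile ‖h x • z‖)
          (integrable_profile.comp_smul hx) x
      exact hi.const_mul (h x ^ 6)
  · refine (h3.mul_const (∫ z : E3, profile ‖z‖)).congr (Eventually.of_forall fun x => ?_)
    have hn : (fun y => ‖h x ^ 6 * profile (h x * ‖x - y‖)‖) =
        fun y => h x ^ 6 * profile (h x * ‖x - y‖) := by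
      funext y
      rw [Real.norm_eq_abs, abs_of_nonneg
        (mul_nonneg (pow_nonneg (h0 x) _) (profile_nonneg _))]
    simp only [hn]
    by_cases hx : h x = 0
    · simp [hx]
    · have hd : Module.finrank ℝ E3 = 3 := by simp
      rw [integral_const_mul, hsl x hx, integral_sub_left_eq_self
        (fun z : E3 => profile ‖h x • z‖) volume x,
        Measure.integral_comp_smul volume (fun z : E3 => profile ‖z‖) (h x), hd,
        abs_of_nonneg (inv_nonneg.2 (pow_nonneg (h0 x) _)), smul_eq_mul]
      field_simp

/-- The kernel `f(x) (4π|x-y|)⁻¹ g(y)`; here `(4π|x-y|)⁻¹` is the kernel of `p⁻² = (-Δ)⁻¹`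
on `ℝ³`. -/
def coulombKernel (f g : E3 → ℝ) (p : E3 × E3) : ℂ :=
  ((f p.1 * (1 / (4 * Real.pi * ‖p.1 - p.2‖)) * g p.2 : ℝ) : ℂ)

/-- The kernel of `f p⁻² g` is square-integrable as soon as `f, g ∈ L³(ℝ³)`. -/
lemma coulombKernel_memLp {f g : E3 → ℝ} (hf : MemLp f 3 volume) (hg : MemLp g 3 volume) :
    MemLp (coulombKernel f g) 2 (volume.prod volume) := by
  have hm : AEStronglyMeasurable (coulombKernel f g) (volume.prod volume) := by
    refine (Complex.measurable_ofReal.comp_aemeasurable ?_).aestronglyMeasurable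
    refine (hf.1.aemeasurable.comp_fst.mul ?_).mul hg.1.aemeasurable.comp_snd
    exact (measurable_const.div
      (measurable_const.mul (measurable_fst.sub measurable_snd).norm)).aemeasurable
  rw [memLp_two_iff_integrable_sq_norm hm]
  set h : E3 → ℝ := fun x => ‖f x‖ + ‖g x‖ with hh
  have h0 : ∀ x, 0 ≤ h x := fun x => by positivity
  have hL : MemLp h 3 volume := hf.norm.add hg.norm
  have h3 : Integrable (fun x => h x ^ 3) := by
    have := hL.integrable_norm_pow (by norm_num)
    refine this.congr (Eventually.of_forall fun x => ?_)
    simp [abs_of_nonneg (h0 x)]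
  have i2 := integrable_profile_term h0 hL
  have i1 := h3.mul_prod h3
  refine ((i1.add i2).add i2.swap).mono' (hm.norm.pow 2) (Eventually.of_forall fun p => ?_)
  obtain ⟨x, y⟩ := p
  have hb : ‖coulombKernel f g (x, y)‖ ^ 2 ≤ (h x * h y / ‖x - y‖) ^ 2 := by
    have hpi : (1 : ℝ) ≤ 4 * Real.pi := by linarith [Real.pi_gt_three]
    simp only [coulombKernel, Complex.norm_real, norm_mul, norm_div, norm_norm, norm_one]
    have hfx : ‖f x‖ ≤ h x := by simp [hh]
    have hgy : ‖g y‖ ≤ h y := by simp [hh]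
    have e : ‖f x‖ * (1 / (‖(4 : ℝ)‖ * ‖Real.pi‖ * ‖x - y‖)) * ‖g y‖ =
        ‖f x‖ * ‖g y‖ / ‖x - y‖ * (4 * Real.pi)⁻¹ := by
      rw [Real.norm_eq_abs (4 : ℝ), Real.norm_eq_abs Real.pi, abs_of_pos Real.pi_pos,
        abs_of_pos (by norm_num : (0 : ℝ) < 4)]
      simp only [one_div, mul_inv]
      ring
    rw [e]
    have : ‖f x‖ * ‖g y‖ / ‖x - y‖ * (4 * Real.pi)⁻¹ ≤ ‖f x‖ * ‖g y‖ / ‖x - y‖ :=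
      mul_le_of_le_one_right (by positivity) (inv_le_one_of_one_le₀ hpi)
    have h2 : ‖f x‖ * ‖g y‖ / ‖x - y‖ ≤ h x * h y / ‖x - y‖ := by
      gcongr
    exact pow_le_pow_left₀ (by positivity) (this.trans h2) 2
  rw [Real.norm_eq_abs, abs_of_nonneg (by positivity)]
  refine hb.trans ?_
  simp only [Pi.add_apply, Function.comp_apply, Prod.swap_prod_mk]
  rcases le_total (h y) (h x) with hxy | hxy
  · have := rollnik_pointwise (h0 y) (norm_nonneg (x - y)) hxy
    have := mul_nonneg (pow_nonneg (h0 y) 6) (profile_nonneg (h y * ‖y - x‖))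
    linarith
  · have := rollnik_pointwise (h0 x) (norm_nonneg (y - x)) hxy
    have := mul_nonneg (pow_nonneg (h0 x) 6) (profile_nonneg (h x * ‖x - y‖))
    rw [norm_sub_rev y x] at *
    rw [mul_comm (h x) (h y)]
    linarith

/-- The bounded operator `f p⁻² g` on `L²(ℝ³)`, for real multiplication operators
`f, g ∈ L³(ℝ³)`. -/
def sandwich (f g : E3 → ℝ) (hf : MemLp f 3 volume) (hg : MemLp g 3 volume) : L2 →L[ℂ] L2 :=
  kernelOp (coulombKernel f g) (coulombKernel_memLp hf hg)

/-! ### Potentials and the Birman–Schwinger operators -/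

/-- A real potential in `L^{3/2}(ℝ³) ∩ L¹(ℝ³, (1+|x|²)dx)`. -/
structure Potential where
  /-- The underlying function. -/
  toFun : E3 → ℝ
  memLp' : MemLp toFun (3 / 2) volume
  integrable' : Integrable (fun x => (1 + ‖x‖ ^ 2) * toFun x) volume

namespace Potential

instance : CoeFun Potential (fun _ => E3 → ℝ) := ⟨Potential.toFun⟩

/-- The sign function with the convention `sgn 0 = 1`. -/
def sgn (t : ℝ) : ℝ := if 0 ≤ t then 1 else -1

lemma measurable_sgn : Measurable sgn :=
  Measurable.ite measurableSet_Ici measurable_const measurable_const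

lemma norm_sgn (t : ℝ) : ‖sgn t‖ = 1 := by
  unfold sgn; split_ifs <;> simp

/-- `J(x) = sgn V(x)`. -/
def J (V : Potential) (x : E3) : ℝ := sgn (V x)

/-- `|V|^{1/2}`. -/
def sqrtAbs (V : Potential) (x : E3) : ℝ := √|V x|

/-- `V^{1/2} = sgn(V) |V|^{1/2}`. -/
def sqrtSgn (V : Potential) (x : E3) : ℝ := V.J x * √|V x|

lemma aemeasurable (V : Potential) : AEMeasurable V volume := V.memLp'.1.aemeasurable

lemma aemeasurable_J (V : Potential) : AEMeasurable V.J volume :=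
  measurable_sgn.comp_aemeasurable V.aemeasurable

lemma sqrtAbs_memLp (V : Potential) : MemLp V.sqrtAbs 3 volume := by
  have hm : AEStronglyMeasurable V.sqrtAbs volume :=
    (V.aemeasurable.abs.sqrt).aestronglyMeasurable
  have h := V.memLp'.integrable_norm_rpow (by norm_num)
    (ENNReal.div_ne_top (by norm_num) (by norm_num))
  have h32 : ((3 / 2 : ℝ≥0∞)).toReal = 3 / 2 := by norm_num
  rw [h32] at h
  rw [← integrable_norm_rpow_iff hm (by norm_num) (by norm_num)]
  refine h.congr (Eventually.of_forall fun x => ?_)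
  simp only [sqrtAbs, Real.norm_eq_abs]
  rw [abs_of_nonneg (Real.sqrt_nonneg _), Real.sqrt_eq_rpow, ← Real.rpow_mul (abs_nonneg _)]
  norm_num

lemma sqrtSgn_memLp (V : Potential) : MemLp V.sqrtSgn 3 volume := by
  have hm : AEStronglyMeasurable V.sqrtSgn volume :=
    (V.aemeasurable_J.mul V.aemeasurable.abs.sqrt).aestronglyMeasurable
  refine V.sqrtAbs_memLp.of_le hm (Eventually.of_forall fun x => ?_)
  simp [sqrtSgn, sqrtAbs, J, norm_sgn, -Real.norm_eq_abs]

/-- The negative part `V⁻ = max(-V, 0)`, so that `V = V⁺ - V⁻`. -/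
def neg (V : Potential) : Potential where
  toFun x := max (-V x) 0
  memLp' := by
    refine V.memLp'.of_le (V.aemeasurable.neg.max aemeasurable_const).aestronglyMeasurable
      (Eventually.of_forall fun x => ?_)
    rw [Real.norm_eq_abs, Real.norm_eq_abs, abs_of_nonneg (le_max_right _ _)]
    exact max_le (neg_le_abs _) (abs_nonneg _)
  integrable' := by
    refine V.integrable'.mono ?_ (Eventually.of_forall fun x => ?_)
    · refine AEMeasurable.aestronglyMeasurable (AEMeasurable.mul ?_
        (V.aemeasurable.neg.max aemeasurable_const))
      exact (measurable_const.add (measurable_norm.pow_const 2)).aemeasurable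
    · rw [norm_mul, norm_mul]
      gcongr
      rw [Real.norm_eq_abs, Real.norm_eq_abs, abs_of_nonneg (le_max_right _ _)]
      exact max_le (neg_le_abs _) (abs_nonneg _)

/-- The Birman–Schwinger operator `B = V^{1/2} p⁻² |V|^{1/2}`. -/
def B (V : Potential) : L2 →L[ℂ] L2 :=
  sandwich V.sqrtSgn V.sqrtAbs V.sqrtSgn_memLp V.sqrtAbs_memLp

/-- The operator `X⁻ = (V⁻)^{1/2} p⁻² (V⁻)^{1/2}`. -/
def Xneg (V : Potential) : L2 →L[ℂ] L2 :=
  sandwich V.neg.sqrtAbs V.neg.sqrtAbs V.neg.sqrtAbs_memLp V.neg.sqrtAbs_memLp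

lemma J_mul_memLp (V : Potential) (φ : L2) : MemLp (fun x => (V.J x : ℂ) * φ x) 2 volume := by
  have hm : AEStronglyMeasurable (fun x => (V.J x : ℂ) * φ x) volume :=
    (Complex.measurable_ofReal.comp_aemeasurable V.aemeasurable_J).aestronglyMeasurable.mul
      (Lp.aestronglyMeasurable φ)
  refine (Lp.memLp φ).of_le hm (Eventually.of_forall fun x => ?_)
  simp [J, norm_sgn, -Real.norm_eq_abs]

/-- The function `J φ ∈ L²(ℝ³)`. -/
def Jmul (V : Potential) (φ : L2) : L2 := (V.J_mul_memLp φ).toLp _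

/-- `P = |φ⟩⟨Jφ| / ⟨Jφ, φ⟩`, that is, `P ψ = (⟨Jφ, ψ⟩ / ⟨Jφ, φ⟩) φ`. -/
def P (V : Potential) (φ : L2) : L2 →L[ℂ] L2 :=
  (inner ℂ (V.Jmul φ) φ)⁻¹ • InnerProductSpace.rankOne ℂ φ (V.Jmul φ)

end Potential

/-- `e` is the lowest (real) eigenvalue of `T`, and it is non-degenerate. -/
structure IsSimpleLowestEigenvalue (T : L2 →L[ℂ] L2) (e : ℝ) : Prop where
  simple : Module.finrank ℂ (Module.End.eigenspace (T : L2 →ₗ[ℂ] L2) (e : ℂ)) = 1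
  lowest : ∀ μ : ℝ, Module.End.HasEigenvalue (T : L2 →ₗ[ℂ] L2) (μ : ℂ) → e ≤ μ

/-- All (real) eigenvalues of `T` other than `e` have distance at least `c` from `0`. -/
def OtherEigenvaluesGapped (T : L2 →L[ℂ] L2) (e c : ℝ) : Prop :=
  ∀ μ : ℝ, Module.End.HasEigenvalue (T : L2 →ₗ[ℂ] L2) (μ : ℂ) → μ ≠ e → c ≤ |μ|

/-- The assumptions on the family `(V ℓ)`, `ℓ > 0`, with the eigenvalues `e ℓ` and `eNeg ℓ`.
That `V ℓ ∈ L^{3/2} ∩ L¹((1+|x|²)dx)` is part of the type `Potential`; values of `V`, `e`, `eNeg`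
at `ℓ ≤ 0` play no role. -/
structure Assumptions (V : ℝ → Potential) (e eNeg : ℝ → ℝ) : Prop where
  /-- `e ℓ` is the lowest eigenvalue of `1 + B`, and non-degenerate. -/
  lowest : ∀ ℓ > 0, IsSimpleLowestEigenvalue (1 + (V ℓ).B) (e ℓ)
  /-- `eNeg ℓ` is the lowest eigenvalue of `1 - X⁻`, and non-degenerate. -/
  lowest_neg : ∀ ℓ > 0, IsSimpleLowestEigenvalue (1 - (V ℓ).Xneg) (eNeg ℓ)
  e_ne_zero : ∀ ℓ > 0, e ℓ ≠ 0
  e_tendsto : Tendsto e (𝓝[>] 0) (𝓝 0)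
  eNeg_isBigO : eNeg =O[𝓝[>] 0] e
  /-- All other eigenvalues are separated from `0` by a gap of order one. -/
  gap : ∃ c > 0, ∀ᶠ ℓ in 𝓝[>] 0, OtherEigenvaluesGapped (1 + (V ℓ).B) (e ℓ) c ∧
    OtherEigenvaluesGapped (1 - (V ℓ).Xneg) (eNeg ℓ) c
  norm_V : (fun ℓ => ∫ x, |V ℓ x|) =O[𝓝[>] 0] (fun _ => (1 : ℝ))
  norm_V_neg : (fun ℓ => ∫ x, |(V ℓ).neg x|) =O[𝓝[>] 0] e
  moment_V : (fun ℓ => ∫ x, |V ℓ x| * ‖x‖ ^ 2) =O[𝓝[>] 0] (fun ℓ => e ℓ ^ 2)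
  moment_V_neg : (fun ℓ => ∫ x, |(V ℓ).neg x| * ‖x‖ ^ 2) =O[𝓝[>] 0] (fun ℓ => e ℓ ^ 3)

end PointInteraction

end

/-! Let `X = |V|^{1/2} p⁻² |V|^{1/2}` and let `Q` be the projection onto functions supported in `{V
< 0}`, so that `J = 1 - 2Q`, `B = JX` and `X⁻ = QXQ`. The form of `1 + JX` at `v` has real part
`‖v‖² + ⟨Xp, p⟩ - ⟨Xq, q⟩` with `p = v - Qv`, `q = Qv`: the cross terms are conjugate and cancel.
Since `X ≥ 0`, only `⟨X⁻q, q⟩` can spoil coercivity, and the gap of `1 - X⁻` confines this danger to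
the ground state `u` of `1 - X⁻` (`le_re_inner_one_add_reflection_mul`, `re_inner_Xneg_le`).

Tested on the eigenvector `φ`, whose eigenvalue is small, the inequality shows that `φ` is nearly
parallel to `u` (`norm_sq_le_of_eigenvector`). A vector `v` orthogonal to `Jφ` therefore has a small
component along `u`, and the form is at least `(c/4)‖v‖²` there
(`coercive_of_orthogonal_reflection`).

Finally `A = 1 + JX` satisfies `JA = A*J`, so `Jφ` is an eigenvector of `A*` and its orthogonal
complement is invariant under `A`. Coercivity and the Fredholm alternative give invertibility and
the bound `4/c` on that complement, onto which `1 - P` projects with norm at most 3.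

The concrete inputs are compactness of operators with square-integrable kernel and positivity of `f
p⁻² f`, the latter from writing `1/|x-y|` as a superposition of products of Gaussians. -/

section Hilbert

/-! ### Abstract estimates for `1 + (1 - 2Q)X` on a Hilbert space. -/

variable {H : Type*} [NormedAddCommGroup H] [InnerProductSpace ℂ H] [CompleteSpace H]

open InnerProductSpace

/-- If all eigenvalues of a compact self-adjoint operator with eigenvectors orthogonal to the unit
eigenvector `u` are at most `m`, then so is its quadratic form on the orthogonal complement of `u`. -/
theorem IsCompactOperator.re_inner_le_of_orthogonal {T : H →L[ℂ] H} (hT : IsCompactOperator T)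
    (hs : IsSelfAdjoint T) {u : H} (hu : ‖u‖ = 1) {t m : ℝ} (hTu : T u = (t : ℂ) • u) (hm : 0 ≤ m)
    (h : ∀ (l : ℝ) (v : H), v ≠ 0 → inner ℂ u v = 0 → T v = (l : ℂ) • v → l ≤ m)
    {w : H} (hw : inner ℂ u w = 0) : (inner ℂ (T w) w).re ≤ m * ‖w‖ ^ 2 := by
  -- Deflation: subtracting `t |u⟩⟨u|` kills `u` and leaves `T` unchanged on the orthogonal
  -- complement.
  set S : H →L[ℂ] H := T - (t : ℂ) • rankOne ℂ u u with hS
  have huu : inner ℂ u u = 1 := by simp [inner_self_eq_norm_sq_to_K, hu]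
  have hSs : IsSelfAdjoint S := by
    refine hs.sub (IsSelfAdjoint.smul ?_ (isPositive_rankOne_self (𝕜 := ℂ) u).isSelfAdjoint)
    simp [isSelfAdjoint_iff]
  have hSc : IsCompactOperator S := by
    have h1 : IsCompactOperator (rankOne ℂ u u : H →L[ℂ] H) := by
      rw [rankOne_def']
      have h2 : IsCompactOperator (innerSL ℂ u) := isCompactOperator_of_locallyCompactSpace_dom _
      exact h2.clm_comp (.toSpanSingleton ℂ u)
    exact hT.sub (h1.smul (t : ℂ))
  have hSu : S u = 0 := by simp [hS, hTu, hu]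
  have hspec : ∀ l ∈ spectrum ℝ S, l ≤ m := by
    intro l hl
    -- The point 0 lies in the spectrum of `S` because `S u = 0`, hence the need for `0 ≤ m`. Any
    -- other spectral point of the compact `S` is an eigenvalue.
    rcases eq_or_ne l 0 with rfl | hl0
    · exact hm
    have hl' : (l : ℂ) ∈ spectrum ℂ S := by
      simpa using (spectrum.algebraMap_mem_iff ℂ (r := l) (a := S)).2 hl
    obtain ⟨v, hv⟩ := ((hSc.hasEigenvalue_iff_mem_spectrum (by exact_mod_cast hl0)).2
      hl').exists_hasEigenvector
    have hSv : S v = (l : ℂ) • v := hv.apply_eq_smul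
    have hor : inner ℂ u v = 0 := by
      have h1 : inner ℂ (S u) v = inner ℂ u (S v) := hSs.isSymmetric u v
      rw [hSu, hSv, inner_zero_left, inner_smul_right] at h1
      rcases mul_eq_zero.1 h1.symm with h2 | h2
      · exact absurd (by exact_mod_cast h2) hl0
      · exact h2
    refine h l v hv.2 hor ?_
    rw [← hSv]
    simp [hS, hor]
  have hle : S ≤ algebraMap ℝ (H →L[ℂ] H) m := le_algebraMap_of_spectrum_le hspec hSs
  have hpos := (ContinuousLinearMap.le_def _ _).1 hle |>.re_inner_nonneg_left w
  have hSw : S w = T w := by simp [hS, hw]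
  have e1 : (algebraMap ℝ (H →L[ℂ] H) m - S) w = (m : ℂ) • w - T w := by
    rw [_root_.sub_apply, hSw, Algebra.algebraMap_eq_smul_one]
    simp
  rw [e1, inner_sub_left, inner_smul_left, inner_self_eq_norm_sq_to_K] at hpos
  simp only [map_sub, RCLike.re_to_complex, Complex.conj_ofReal, Complex.coe_algebraMap] at hpos
  have e2 : ((m : ℂ) * (‖w‖ : ℂ) ^ 2).re = m * ‖w‖ ^ 2 := by norm_cast
  rw [e2] at hpos
  linarith

/-- Self-adjointness makes the complement of `u` invariant, so along `v = a u + w` the form splits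
without cross terms into `t ‖a‖²` and the form at `w`. -/
theorem IsCompactOperator.re_inner_le {T : H →L[ℂ] H} (hT : IsCompactOperator T)
    (hs : IsSelfAdjoint T) {u : H} (hu : ‖u‖ = 1) {t m : ℝ} (hTu : T u = (t : ℂ) • u) (hm : 0 ≤ m)
    (h : ∀ (l : ℝ) (v : H), v ≠ 0 → inner ℂ u v = 0 → T v = (l : ℂ) • v → l ≤ m) (v : H) :
    (inner ℂ (T v) v).re ≤ m * ‖v‖ ^ 2 + (t - m) * ‖inner ℂ u v‖ ^ 2 := by
  have huu : inner ℂ u u = 1 := by simp [inner_self_eq_norm_sq_to_K, hu]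
  set a : ℂ := inner ℂ u v with ha
  set w : H := v - a • u with hw
  have hvw : v = a • u + w := by simp [hw]
  have hor : inner ℂ u w = 0 := by simp [hw, hu, ha]
  have hor' : inner ℂ w u = 0 := inner_eq_zero_symm.1 hor
  have hTw : inner ℂ (T w) u = 0 := by
    have h1 : inner ℂ (T w) u = inner ℂ w (T u) := hs.isSymmetric w u
    rw [h1, hTu, inner_smul_right, hor', mul_zero]
  have key := hT.re_inner_le_of_orthogonal hs hu hTu hm h hor
  have n1 : ‖v‖ ^ 2 = ‖a‖ ^ 2 + ‖w‖ ^ 2 := by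
    have := norm_add_sq_eq_norm_sq_add_norm_sq_of_inner_eq_zero (𝕜 := ℂ) (a • u) w
      (by rw [inner_smul_left, hor, mul_zero])
    rw [← hvw, norm_smul, hu, mul_one] at this
    nlinarith
  have n2 : (inner ℂ (T v) v).re = t * ‖a‖ ^ 2 + (inner ℂ (T w) w).re := by
    have e1 : inner ℂ (T v) v = (t : ℂ) * (‖a‖ : ℂ) ^ 2 + inner ℂ (T w) w := by
      rw [hvw, map_add, map_smul, hTu]
      simp only [inner_add_left, inner_add_right, inner_smul_left, inner_smul_right, hor, huu, hTw,
        mul_zero, add_zero, mul_one, Complex.conj_ofReal, zero_add]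
      rw [← Complex.conj_mul']
      ring
    rw [e1, Complex.add_re]
    norm_cast
  rw [n2, n1]
  nlinarith

/-- If `A = 1 + (1 - 2Q)X` with `X ≥ 0` and a projection `Q`, then a bound on the form of `Q X Q` gives
a lower bound on the real part of the form of `A`. -/
theorem le_re_inner_one_add_reflection_mul {A X Q : H →L[ℂ] H} (hX : X.IsPositive)
    (hQ : IsSelfAdjoint Q) (hQQ : Q * Q = Q) (hA : ∀ v, A v = v + (X v - (2 : ℂ) • Q (X v)))
    {u : H} {c e' : ℝ}
    (hT : ∀ v, (inner ℂ ((Q * X * Q) v) v).re ≤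
      (1 - c) * ‖v‖ ^ 2 + (c - e') * ‖inner ℂ u v‖ ^ 2) (v : H) :
    ‖v - Q v‖ ^ 2 + c * ‖Q v‖ ^ 2 - (c - e') * ‖inner ℂ u (Q v)‖ ^ 2 ≤ (inner ℂ v (A v)).re := by
  have hQs : ∀ x y, inner ℂ (Q x) y = inner ℂ x (Q y) := fun x y => hQ.isSymmetric x y
  have hXs : ∀ x y, inner ℂ (X x) y = inner ℂ x (X y) := fun x y => hX.isSymmetric x y
  have hQQ' : ∀ x, Q (Q x) = Q x := fun x => congrArg (fun f : H →L[ℂ] H => f x) hQQ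
  set p := v - Q v with hp
  have hv : v = p + Q v := by simp [hp]
  have hor : inner ℂ p (Q v) = 0 := by
    rw [← hQs, hp, map_sub, hQQ', sub_self, inner_zero_left]
  have n1 : ‖v‖ ^ 2 = ‖p‖ ^ 2 + ‖Q v‖ ^ 2 := by
    have := norm_add_sq_eq_norm_sq_add_norm_sq_of_inner_eq_zero (𝕜 := ℂ) p (Q v) hor
    rw [← hv] at this
    nlinarith
  have e1 : inner ℂ v (A v) = inner ℂ v v + inner ℂ (p - Q v) (X v) := by
    have : p - Q v = v - (2 : ℂ) • Q v := by rw [hp, two_smul]; abel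
    rw [this, hA, inner_sub_left, inner_smul_left, hQs, inner_add_right, inner_sub_right,
      inner_smul_right, Complex.conj_ofNat]
  have e2 : (inner ℂ (p - Q v) (X v)).re =
      (inner ℂ (X p) p).re - (inner ℂ (X (Q v)) (Q v)).re := by
    -- The two cross terms are complex conjugates entering with opposite signs.
    have c1 : (inner ℂ p (X (Q v))).re = (inner ℂ (Q v) (X p)).re := by
      rw [← hXs, ← inner_conj_symm, Complex.conj_re]
    conv_lhs => rw [show X v = X p + X (Q v) by rw [← map_add, ← hv]]
    simp only [inner_sub_left, inner_add_right, Complex.sub_re, Complex.add_re, hXs]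
    linarith
  have e3 : inner ℂ ((Q * X * Q) (Q v)) (Q v) = inner ℂ (X (Q v)) (Q v) := by
    simp [hQs, hQQ']
  have e4 : (inner ℂ v v).re = ‖v‖ ^ 2 := by
    rw [inner_self_eq_norm_sq_to_K]; norm_cast
  have h1 := hT (Q v)
  have h2 : 0 ≤ (inner ℂ (X p) p).re := hX.re_inner_nonneg_left p
  rw [e3] at h1
  rw [e1, Complex.add_re, e2, e4, n1]
  linarith

/-- An eigenvector of `A = 1 + (1 - 2Q)X` to a small eigenvalue is almost in the range of `Q` and
almost parallel to `u`. -/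
theorem norm_sq_le_of_eigenvector {A X Q : H →L[ℂ] H} (hX : X.IsPositive)
    (hQ : IsSelfAdjoint Q) (hQQ : Q * Q = Q) (hA : ∀ v, A v = v + (X v - (2 : ℂ) • Q (X v)))
    {u : H} (hu : ‖u‖ = 1) {c e e' : ℝ} (hc : 0 < c) (hc1 : c ≤ 1)
    (he : |e| ≤ c ^ 2 / 64) (he' : |e'| ≤ c ^ 2 / 64)
    (hT : ∀ v, (inner ℂ ((Q * X * Q) v) v).re ≤
      (1 - c) * ‖v‖ ^ 2 + (c - e') * ‖inner ℂ u v‖ ^ 2)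
    {φ : H} (hφ : A φ = (e : ℂ) • φ) :
    ‖φ - Q φ‖ ^ 2 ≤ c / 16 * ‖Q φ‖ ^ 2 ∧
      ‖Q φ - inner ℂ u (Q φ) • u‖ ^ 2 ≤ c / 16 * ‖Q φ‖ ^ 2 ∧
      ‖Q φ - inner ℂ u (Q φ) • u‖ ^ 2 + ‖inner ℂ u (Q φ)‖ ^ 2 = ‖Q φ‖ ^ 2 ∧
      ‖φ - Q φ‖ ^ 2 + ‖Q φ‖ ^ 2 = ‖φ‖ ^ 2 := by
  have hQQ' : ∀ x, Q (Q x) = Q x := fun x => congrArg (fun f : H →L[ℂ] H => f x) hQQ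
  have key := le_re_inner_one_add_reflection_mul hX hQ hQQ hA hT φ
  have huu : inner ℂ u u = 1 := by simp [inner_self_eq_norm_sq_to_K, hu]
  set p := φ - Q φ with hp
  set q := Q φ with hq
  set a : ℂ := inner ℂ u q with ha
  have n1 : ‖p‖ ^ 2 + ‖q‖ ^ 2 = ‖φ‖ ^ 2 := by
    have := norm_add_sq_eq_norm_sq_add_norm_sq_of_inner_eq_zero (𝕜 := ℂ) p q (by
      have h1 : inner ℂ (Q p) φ = inner ℂ p (Q φ) := hQ.isSymmetric p φ
      rw [hq, ← h1, hp, map_sub, hQQ', sub_self, inner_zero_left])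
    rw [show p + q = φ by simp [hp]] at this
    nlinarith
  have n2 : ‖q - a • u‖ ^ 2 + ‖a‖ ^ 2 = ‖q‖ ^ 2 := by
    have := norm_add_sq_eq_norm_sq_add_norm_sq_of_inner_eq_zero (𝕜 := ℂ) (a • u) (q - a • u) (by
      rw [inner_smul_left, inner_sub_right, inner_smul_right, huu, mul_one, ← ha, sub_self,
        mul_zero])
    rw [add_sub_cancel, norm_smul, hu, mul_one] at this
    nlinarith
  have e1 : (inner ℂ φ (A φ)).re = e * ‖φ‖ ^ 2 := by
    rw [hφ, inner_smul_right, inner_self_eq_norm_sq_to_K]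
    rw [Complex.re_ofReal_mul]
    norm_cast
  rw [e1, ← n1] at key
  have he1 := abs_le.1 he
  have he2 := abs_le.1 he'
  have hcc : c ^ 2 ≤ c := by nlinarith
  have hr := sq_nonneg ‖q - a • u‖
  have hp0 := sq_nonneg ‖p‖
  have ha0 := sq_nonneg ‖a‖
  -- Splitting `‖q‖²` along `u` cancels the terms `c ‖a‖²`; only the small difference `e - e'` is
  -- left in front of `‖a‖²`.
  have s1 : (1 - e) * ‖p‖ ^ 2 + (c - e) * ‖q - a • u‖ ^ 2 ≤ (e - e') * ‖a‖ ^ 2 := by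
    rw [← n2] at key; linarith
  have s2 : (e - e') * ‖a‖ ^ 2 ≤ c ^ 2 / 32 * ‖q‖ ^ 2 := by
    have : (e - e') * ‖a‖ ^ 2 ≤ c ^ 2 / 32 * ‖a‖ ^ 2 := by gcongr; linarith
    have : c ^ 2 / 32 * ‖a‖ ^ 2 ≤ c ^ 2 / 32 * ‖q‖ ^ 2 :=
      mul_le_mul_of_nonneg_left (by linarith) (by positivity)
    linarith
  have s3 : c / 2 * ‖p‖ ^ 2 ≤ (1 - e) * ‖p‖ ^ 2 := by gcongr; linarith
  have s4 : c / 2 * ‖q - a • u‖ ^ 2 ≤ (c - e) * ‖q - a • u‖ ^ 2 := by gcongr; linarith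
  have s5 : c ^ 2 / 32 * ‖q‖ ^ 2 = c / 2 * (c / 16 * ‖q‖ ^ 2) := by ring
  have hc2 : 0 < c / 2 := by positivity
  have s6 : 0 ≤ c / 2 * ‖p‖ ^ 2 := by positivity
  have s7 : 0 ≤ c / 2 * ‖q - a • u‖ ^ 2 := by positivity
  exact ⟨le_of_mul_le_mul_left (by linarith) hc2, le_of_mul_le_mul_left (by linarith) hc2, n2, n1⟩

/-- `A = 1 + (1 - 2Q)X` is coercive on the `J`-orthogonal complement of its low-lying eigenvector,
where `J = 1 - 2Q`. -/
theorem coercive_of_orthogonal_reflection {A X Q : H →L[ℂ] H} (hX : X.IsPositive)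
    (hQ : IsSelfAdjoint Q) (hQQ : Q * Q = Q) (hA : ∀ v, A v = v + (X v - (2 : ℂ) • Q (X v)))
    {u : H} (hu : ‖u‖ = 1) {c e e' : ℝ} (hc : 0 < c) (hc1 : c ≤ 1)
    (he : |e| ≤ c ^ 2 / 64) (he' : |e'| ≤ c ^ 2 / 64)
    (hT : ∀ v, (inner ℂ ((Q * X * Q) v) v).re ≤
      (1 - c) * ‖v‖ ^ 2 + (c - e') * ‖inner ℂ u v‖ ^ 2)
    {φ : H} (hφ0 : φ ≠ 0) (hφ : A φ = (e : ℂ) • φ) {v : H}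
    (hv : inner ℂ (φ - (2 : ℂ) • Q φ) v = 0) :
    c / 4 * ‖v‖ ^ 2 ≤ (inner ℂ v (A v)).re := by
  have hQs : ∀ x y, inner ℂ (Q x) y = inner ℂ x (Q y) := fun x y => hQ.isSymmetric x y
  have hQQ' : ∀ x, Q (Q x) = Q x := fun x => congrArg (fun f : H →L[ℂ] H => f x) hQQ
  obtain ⟨b1, b2, b3, b4⟩ := norm_sq_le_of_eigenvector hX hQ hQQ hA hu hc hc1 he he' hT hφ
  have key := le_re_inner_one_add_reflection_mul hX hQ hQQ hA hT v
  set a : ℂ := inner ℂ u (Q φ) with ha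
  set b : ℂ := inner ℂ u (Q v) with hb
  -- If `Q φ` vanished, `b1` would make `φ - Q φ` vanish too.
  have hN : 0 < ‖Q φ‖ ^ 2 := by
    have h1 : 0 < ‖φ‖ ^ 2 := by positivity
    by_contra h
    have h2 : ‖Q φ‖ ^ 2 = 0 := le_antisymm (not_lt.1 h) (sq_nonneg _)
    rw [h2] at b1 b4
    linarith
  -- This is the hypothesis `hv`, because `(1 - 2Q)φ = (φ - Q φ) - Q φ`.
  have o1 : inner ℂ (φ - Q φ) (v - Q v) = inner ℂ (Q φ) (Q v) := by
    have h1 : inner ℂ (φ - Q φ) (Q v) = 0 := by rw [← hQs, map_sub, hQQ', sub_self, inner_zero_left]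
    have h2 : inner ℂ (Q φ) (v - Q v) = 0 := by rw [hQs, map_sub, hQQ', sub_self, inner_zero_right]
    rw [show φ - (2 : ℂ) • Q φ = (φ - Q φ) - Q φ by rw [two_smul]; abel,
      show v = (v - Q v) + Q v by abel, inner_sub_left, inner_add_right, inner_add_right] at hv
    rw [h1, h2] at hv
    linear_combination hv
  have o2 : inner ℂ (Q φ) (Q v) =
      (starRingEnd ℂ) a * b + inner ℂ (Q φ - a • u) (Q v) := by
    rw [inner_sub_left, inner_smul_left]; ring
  have n1 : ‖v - Q v‖ ^ 2 + ‖Q v‖ ^ 2 = ‖v‖ ^ 2 := by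
    have := norm_add_sq_eq_norm_sq_add_norm_sq_of_inner_eq_zero (𝕜 := ℂ) (v - Q v) (Q v) (by
      rw [← hQs, map_sub, hQQ', sub_self, inner_zero_left])
    rw [sub_add_cancel] at this
    nlinarith
  -- Each product on the right contains one factor that is small by the estimates on `φ`, while
  -- `‖a‖` is comparable to `‖Q φ‖`; hence `‖b‖` is small.
  have o3 : ‖a‖ * ‖b‖ ≤ ‖φ - Q φ‖ * ‖v - Q v‖ + ‖Q φ - a • u‖ * ‖Q v‖ := by
    have h1 : (starRingEnd ℂ) a * b =
        inner ℂ (φ - Q φ) (v - Q v) - inner ℂ (Q φ - a • u) (Q v) := by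
      rw [o1, o2]; ring
    calc ‖a‖ * ‖b‖ = ‖(starRingEnd ℂ) a * b‖ := by simp
      _ ≤ ‖inner ℂ (φ - Q φ) (v - Q v)‖ + ‖inner ℂ (Q φ - a • u) (Q v)‖ := by
          rw [h1]; exact norm_sub_le _ _
      _ ≤ _ := add_le_add (norm_inner_le_norm _ _) (norm_inner_le_norm _ _)
  have o4 : (‖a‖ * ‖b‖) ^ 2 ≤ c / 8 * ‖Q φ‖ ^ 2 * ‖v‖ ^ 2 := by
    have h1 := pow_le_pow_left₀ (by positivity) o3 2
    have h2 : (‖φ - Q φ‖ * ‖v - Q v‖ + ‖Q φ - a • u‖ * ‖Q v‖) ^ 2 ≤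
        (‖φ - Q φ‖ ^ 2 + ‖Q φ - a • u‖ ^ 2) * (‖v - Q v‖ ^ 2 + ‖Q v‖ ^ 2) := by
      nlinarith [sq_nonneg (‖φ - Q φ‖ * ‖Q v‖ - ‖Q φ - a • u‖ * ‖v - Q v‖)]
    rw [n1] at h2
    have h3 : (‖φ - Q φ‖ ^ 2 + ‖Q φ - a • u‖ ^ 2) * ‖v‖ ^ 2 ≤ c / 8 * ‖Q φ‖ ^ 2 * ‖v‖ ^ 2 := by
      gcongr; linarith
    linarith
  have o5 : 15 / 16 * ‖Q φ‖ ^ 2 ≤ ‖a‖ ^ 2 := by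
    have : c / 16 * ‖Q φ‖ ^ 2 ≤ 1 / 16 * ‖Q φ‖ ^ 2 := by gcongr
    linarith
  have o6 : 15 / 16 * ‖b‖ ^ 2 ≤ c / 8 * ‖v‖ ^ 2 := by
    have h1 : 15 / 16 * ‖Q φ‖ ^ 2 * ‖b‖ ^ 2 ≤ ‖a‖ ^ 2 * ‖b‖ ^ 2 := by gcongr
    rw [mul_pow] at o4
    exact le_of_mul_le_mul_left (by linarith) hN
  have hcc : c ^ 2 ≤ c := by nlinarith
  have he2 := abs_le.1 he'
  -- With `o6` the loss is at most `(65/64)(2/15) c ‖v‖²`, well below `(3/4) c ‖v‖²`.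
  have k1 : (c - e') * ‖b‖ ^ 2 ≤ 65 / 64 * ‖b‖ ^ 2 := by gcongr; linarith
  have k2 : c * ‖v - Q v‖ ^ 2 ≤ 1 * ‖v - Q v‖ ^ 2 := by gcongr
  have k3 : c * ‖v - Q v‖ ^ 2 + c * ‖Q v‖ ^ 2 = c * ‖v‖ ^ 2 := by rw [← n1]; ring
  have k4 : 0 ≤ c * ‖v‖ ^ 2 := by positivity
  linarith

/-- The reduced resolvent bound for `A = 1 + (1 - 2Q)X` at a low-lying eigenvalue `e`. -/
theorem reduced_resolvent_bound {A X Q : H →L[ℂ] H} (hX : X.IsPositive)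
    (hQ : IsSelfAdjoint Q) (hQQ : Q * Q = Q) (hA : ∀ v, A v = v + (X v - (2 : ℂ) • Q (X v)))
    (hcomp : IsCompactOperator (A - 1 : H →L[ℂ] H))
    {u : H} (hu : ‖u‖ = 1) {c e e' : ℝ} (hc : 0 < c) (hc1 : c ≤ 1)
    (he : |e| ≤ c ^ 2 / 64) (he' : |e'| ≤ c ^ 2 / 64)
    (hT : ∀ v, (inner ℂ ((Q * X * Q) v) v).re ≤
      (1 - c) * ‖v‖ ^ 2 + (c - e') * ‖inner ℂ u v‖ ^ 2)
    (he0 : e ≠ 0) {φ χ : H} (hφ0 : φ ≠ 0) (hφ : A φ = (e : ℂ) • φ) (hχ : χ = φ - (2 : ℂ) • Q φ) :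
    IsUnit A ∧ inner ℂ χ φ ≠ 0 ∧
      ‖Ring.inverse A * (1 - (inner ℂ χ φ)⁻¹ • rankOne ℂ φ χ)‖ ≤ 12 / c ∧
      Ring.inverse A * ((inner ℂ χ φ)⁻¹ • rankOne ℂ φ χ) =
        (e : ℂ)⁻¹ • ((inner ℂ χ φ)⁻¹ • rankOne ℂ φ χ) := by
  have hQs : ∀ x y, inner ℂ (Q x) y = inner ℂ x (Q y) := fun x y => hQ.isSymmetric x y
  have hXs : ∀ x y, inner ℂ (X x) y = inner ℂ x (X y) := fun x y => hX.isSymmetric x y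
  have hQQ' : ∀ x, Q (Q x) = Q x := fun x => congrArg (fun f : H →L[ℂ] H => f x) hQQ
  have he0' : (e : ℂ) ≠ 0 := by exact_mod_cast he0
  obtain ⟨b1, -, -, b4⟩ := norm_sq_le_of_eigenvector hX hQ hQQ hA hu hc hc1 he he' hT hφ
  have hφ2 : 0 < ‖φ‖ ^ 2 := by positivity
  have hχs : χ = (φ - Q φ) - Q φ := by rw [hχ, two_smul]; abel
  have hor : inner ℂ (φ - Q φ) (Q φ) = 0 := by
    rw [← hQs, map_sub, hQQ', sub_self, inner_zero_left]
  have hχn : ‖χ‖ = ‖φ‖ := by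
    have h1 := norm_add_sq_eq_norm_sq_add_norm_sq_of_inner_eq_zero (𝕜 := ℂ) (φ - Q φ) (-Q φ)
      (by rw [inner_neg_right, hor, neg_zero])
    rw [← sub_eq_add_neg, ← hχs, norm_neg] at h1
    have : ‖χ‖ ^ 2 = ‖φ‖ ^ 2 := by nlinarith
    exact (sq_eq_sq₀ (norm_nonneg _) (norm_nonneg _)).1 this
  set s : ℂ := inner ℂ χ φ with hs
  have hsval : s = ((‖φ - Q φ‖ ^ 2 - ‖Q φ‖ ^ 2 : ℝ) : ℂ) := by
    have hor' : inner ℂ (Q φ) (φ - Q φ) = 0 := inner_eq_zero_symm.1 hor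
    rw [hs, hχs]
    nth_rw 4 [show φ = (φ - Q φ) + Q φ by abel]
    rw [inner_sub_left, inner_add_right, inner_add_right, hor, hor',
      inner_self_eq_norm_sq_to_K, inner_self_eq_norm_sq_to_K]
    push_cast
    simp
  -- `Q φ` carries nearly all of the norm of `φ`, so `s` is close to `-‖φ‖²`.
  have hsn : ‖φ‖ ^ 2 / 2 ≤ ‖s‖ := by
    rw [hsval, Complex.norm_real, Real.norm_eq_abs, abs_sub_comm]
    refine le_trans ?_ (le_abs_self _)
    have : c / 16 * ‖Q φ‖ ^ 2 ≤ 1 / 16 * ‖Q φ‖ ^ 2 := by gcongr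
    linarith
  have hs0 : s ≠ 0 := norm_pos_iff.1 (by linarith)
  -- `χ` is an eigenvector of the adjoint of `A`: the eigenvalue equation says `X φ = (e - 1) χ`,
  -- and `(1 - 2Q)² = 1`.
  have hχA : ∀ v, inner ℂ χ (A v) = (e : ℂ) * inner ℂ χ v := by
    have hXφ : X φ = ((e : ℂ) - 1) • χ := by
      have h1 := hA φ
      rw [hφ] at h1
      have h2 : X φ - (2 : ℂ) • Q (X φ) = ((e : ℂ) - 1) • φ := by
        rw [sub_smul, one_smul, h1]; abel
      have h3 : -Q (X φ) = ((e : ℂ) - 1) • Q φ := by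
        have := congrArg Q h2
        rw [map_sub, map_smul, map_smul, hQQ', two_smul] at this
        rw [← this]; abel
      rw [hχ, smul_sub, smul_comm, ← h3, ← h2, smul_neg]
      abel
    intro v
    have hχJ : inner ℂ χ (X v - (2 : ℂ) • Q (X v)) = inner ℂ φ (X v) := by
      rw [hχ, inner_sub_left, inner_sub_right, inner_sub_right, inner_smul_left, inner_smul_left,
        inner_smul_right, inner_smul_right, hQs, hQs, hQQ', Complex.conj_ofNat]
      ring
    rw [hA, inner_add_right, hχJ, ← hXs, hXφ, inner_smul_left, map_sub, Complex.conj_ofReal,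
      map_one]
    ring
  have hcoer : ∀ v, inner ℂ χ v = 0 → c / 4 * ‖v‖ ^ 2 ≤ (inner ℂ v (A v)).re := fun v hv =>
    coercive_of_orthogonal_reflection hX hQ hQQ hA hu hc hc1 he he' hT hφ0 hφ (hχ ▸ hv)
  -- Fredholm alternative: as `e ≠ 0`, a kernel vector is orthogonal to `χ`, and coercivity forces
  -- it to vanish.
  have hunit : IsUnit A := by
    rcases IsCompactOperator.hasEigenvalue_or_mem_resolventSet (T := A - 1) (μ := (-1 : ℂ)) hcomp
      (by norm_num) with h | h
    · obtain ⟨v, hv⟩ := h.exists_hasEigenvector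
      have hAv : A v = 0 := by
        have h1 : (A - 1) v = (-1 : ℂ) • v := hv.apply_eq_smul
        simpa using h1
      have h2 : inner ℂ χ v = 0 := by
        have h1 := hχA v
        rw [hAv, inner_zero_right] at h1
        exact (mul_eq_zero.1 h1.symm).resolve_left he0'
      have h3 := hcoer v h2
      rw [hAv, inner_zero_right, Complex.zero_re] at h3
      have h4 : 0 < ‖v‖ := norm_pos_iff.2 hv.2
      have h5 : 0 < c / 4 * ‖v‖ ^ 2 := by positivity
      linarith
    · have h1 := (spectrum.mem_resolventSet_iff.1 h).neg
      simpa using h1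
  have hinv : ∀ v, A (Ring.inverse A v) = v := fun v =>
    congrArg (fun f : H →L[ℂ] H => f v) (Ring.mul_inverse_cancel A hunit)
  have hinv' : ∀ v, Ring.inverse A (A v) = v := fun v =>
    congrArg (fun f : H →L[ℂ] H => f v) (Ring.inverse_mul_cancel A hunit)
  refine ⟨hunit, hs0, ?_, ?_⟩
  -- The constant is `12/c = 3 · (4/c)`: the projection has norm at most 2, its complement at most
  -- 3, and coercivity bounds the inverse by `4/c`.
  · refine ContinuousLinearMap.opNorm_le_bound _ (by positivity) fun v => ?_
    set w : H := v - (s⁻¹ * inner ℂ χ v) • φ with hw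
    have hw0 : inner ℂ χ w = 0 := by
      rw [hw, inner_sub_right, inner_smul_right, ← hs]
      field_simp
      ring
    have hwn : ‖w‖ ≤ 3 * ‖v‖ := by
      have h1 : ‖(s⁻¹ * inner ℂ χ v) • φ‖ ≤ 2 * ‖v‖ := by
        rw [norm_smul, norm_mul, norm_inv]
        have h2 : ‖inner ℂ χ v‖ ≤ ‖φ‖ * ‖v‖ := hχn ▸ norm_inner_le_norm χ v
        have h3 : 0 < ‖s‖ := norm_pos_iff.2 hs0
        calc ‖s‖⁻¹ * ‖inner ℂ χ v‖ * ‖φ‖ ≤ ‖s‖⁻¹ * (‖φ‖ * ‖v‖) * ‖φ‖ := by gcongr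
          _ = ‖s‖⁻¹ * (‖φ‖ ^ 2 * ‖v‖) := by ring
          _ ≤ ‖s‖⁻¹ * (2 * ‖s‖ * ‖v‖) := by gcongr; linarith
          _ = 2 * ‖v‖ := by field_simp
      calc ‖w‖ ≤ ‖v‖ + ‖(s⁻¹ * inner ℂ χ v) • φ‖ := norm_sub_le _ _
        _ ≤ 3 * ‖v‖ := by linarith
    have hval : (Ring.inverse A * (1 - s⁻¹ • rankOne ℂ φ χ)) v = Ring.inverse A w := by
      simp [hw, smul_smul]
    rw [hval]
    set z := Ring.inverse A w with hz
    have hAz : A z = w := hinv w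
    have hz0 : inner ℂ χ z = 0 := by
      have h1 := hχA z
      rw [hAz, hw0] at h1
      exact (mul_eq_zero.1 h1.symm).resolve_left he0'
    have h1 := hcoer z hz0
    rw [hAz] at h1
    have h2 : (inner ℂ z w).re ≤ ‖z‖ * ‖w‖ := re_inner_le_norm (𝕜 := ℂ) z w
    have h3 : ‖z‖ * ‖w‖ ≤ ‖z‖ * (3 * ‖v‖) := by gcongr
    rcases (norm_nonneg z).eq_or_lt with h0 | h0
    · rw [← h0]; positivity
    · have h4 : c / 4 * ‖z‖ ≤ 3 * ‖v‖ := le_of_mul_le_mul_left (by linarith) h0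
      rw [div_mul_eq_mul_div, le_div_iff₀ hc]
      linarith
  · ext1 v
    have h1 : Ring.inverse A φ = (e : ℂ)⁻¹ • φ := by
      have := hinv' φ
      rw [hφ, map_smul] at this
      rw [← this, smul_smul, inv_mul_cancel₀ he0', one_smul, this]
    simp [h1, smul_smul]
    ring_nf

end Hilbert

/-! ### Weak compactness and compactness of Hilbert–Schmidt operators. -/

/-- Bounded sequences in a separable Hilbert space have weakly convergent subsequences. -/
theorem exists_subseq_tendsto_inner {H : Type*} [NormedAddCommGroup H] [InnerProductSpace ℂ H]
    [CompleteSpace H] [TopologicalSpace.SeparableSpace H] {x : ℕ → H} {r : ℝ}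
    (hx : ∀ n, ‖x n‖ ≤ r) :
    ∃ a : H, ‖a‖ ≤ r ∧ ∃ σ : ℕ → ℕ, StrictMono σ ∧
      ∀ y, Tendsto (fun n => inner ℂ (x (σ n)) y) atTop (𝓝 (inner ℂ a y)) := by
  -- Riesz representation turns the claim into sequential Banach–Alaoglu.
  let f : ℕ → WeakDual ℂ H := fun n => StrongDual.toWeakDual (InnerProductSpace.toDual ℂ H (x n))
  have hf : ∀ n, f n ∈ WeakDual.toStrongDual ⁻¹'
      Metric.closedBall (0 : StrongDual ℂ H) r := fun n => by
    change InnerProductSpace.toDual ℂ H (x n) ∈ Metric.closedBall (0 : StrongDual ℂ H) r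
    simpa using hx n
  obtain ⟨g, hg, σ, hσ, hlim⟩ := WeakDual.isSeqCompact_closedBall ℂ H 0 r hf
  refine ⟨(InnerProductSpace.toDual ℂ H).symm (WeakDual.toStrongDual g), ?_, σ, hσ, fun y => ?_⟩
  · simpa using hg
  · have h1 := ((WeakDual.eval_continuous (𝕜 := ℂ) y).tendsto g).comp hlim
    have h2 : inner ℂ ((InnerProductSpace.toDual ℂ H).symm (WeakDual.toStrongDual g)) y = g y := by
      rw [InnerProductSpace.toDual_symm_apply]; rfl
    rw [h2]
    refine h1.congr fun n => ?_
    change InnerProductSpace.toDual ℂ H (x (σ n)) y = _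
    rw [InnerProductSpace.toDual_apply_apply]

namespace PointInteraction

/-- An operator with square-integrable kernel maps weakly null bounded sequences to null
sequences. -/
theorem tendsto_kernelOp_of_weakly_null (K : E3 × E3 → ℂ) (hK : MemLp K 2 (volume.prod volume))
    {ψ : ℕ → L2} {M : ℝ} (hM : ∀ n, ‖ψ n‖ ≤ M)
    (hψ : ∀ y, Tendsto (fun n => inner ℂ (ψ n) y) atTop (𝓝 0)) :
    Tendsto (fun n => kernelOp K hK (ψ n)) atTop (𝓝 0) := by
  have hm : AEMeasurable (fun p : E3 × E3 => ‖K p‖ₑ ^ (2 : ℝ)) (volume.prod volume) :=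
    hK.1.enorm.pow_const _
  have hfin : ∫⁻ x, (∫⁻ y, ‖K (x, y)‖ₑ ^ (2 : ℝ)) * ENNReal.ofReal M ^ (2 : ℝ) ≠ ∞ := by
    have h1 := hK.eLpNorm_lt_top
    rw [eLpNorm_lt_top_iff_lintegral_rpow_enorm_lt_top (by norm_num) (by norm_num)] at h1
    simp only [ENNReal.toReal_ofNat] at h1
    rw [lintegral_prod _ hm] at h1
    rw [lintegral_mul_const'' _ hm.lintegral_prod_right']
    exact (ENNReal.mul_lt_top h1
      (ENNReal.rpow_lt_top_of_nonneg (by norm_num) ENNReal.ofReal_ne_top)).ne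
  -- Dominated convergence in `x`: each slice `K(x, ·)` is in `L²`, so weak convergence gives
  -- pointwise decay, and Cauchy–Schwarz gives the majorant.
  have hint : Tendsto (fun n => ∫⁻ x, ‖∫ y, K (x, y) * ψ n y‖ₑ ^ (2 : ℝ)) atTop (𝓝 0) := by
    have h0 : (0 : ℝ≥0∞) = ∫⁻ _ : E3, 0 := by simp
    rw [h0]
    refine tendsto_lintegral_of_dominated_convergence' _ (fun n => ?_) (fun n => ?_) hfin ?_
    · exact ((kernel_memLp K hK (ψ n)).1.enorm.pow_const _)
    · filter_upwards [kernel_pairing_lintegral_le K hK.1 (ψ n)] with x hx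
      have hn : eLpNorm (ψ n) 2 volume ≤ ENNReal.ofReal M := by
        have := hM n
        rw [Lp.norm_def] at this
        exact (ENNReal.le_ofReal_iff_toReal_le (Lp.eLpNorm_ne_top _)
          ((norm_nonneg _).trans (hM n))).2 this
      calc ‖∫ y, K (x, y) * ψ n y‖ₑ ^ (2 : ℝ)
          ≤ ((∫⁻ y, ‖K (x, y)‖ₑ ^ (2 : ℝ)) ^ (1 / 2 : ℝ) * ENNReal.ofReal M) ^ (2 : ℝ) := by
            gcongr
            exact ((enorm_integral_le_lintegral_enorm _).trans hx).trans (by gcongr)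
        _ = _ := by
            rw [ENNReal.mul_rpow_of_nonneg _ _ (by norm_num), ← ENNReal.rpow_mul]
            norm_num
    · filter_upwards [kernel_slice_lt_top K hK, hK.1.prodMk_left] with x h1 h2
      have hs : MemLp (fun y => (starRingEnd ℂ) (K (x, y))) 2 volume := by
        refine ⟨Complex.continuous_conj.comp_aestronglyMeasurable h2, ?_⟩
        rw [eLpNorm_lt_top_iff_lintegral_rpow_enorm_lt_top (by norm_num) (by norm_num)]
        simpa only [ENNReal.toReal_ofNat, RCLike.enorm_conj] using h1
      have e1 : ∀ n, ∫ y, K (x, y) * ψ n y = (starRingEnd ℂ) (inner ℂ (ψ n) (hs.toLp _)) := by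
        intro n
        rw [inner_conj_symm, L2.inner_def]
        refine integral_congr_ae ?_
        filter_upwards [hs.coeFn_toLp] with y hy
        rw [hy]
        simp [mul_comm]
      have h3 := (Complex.continuous_conj.tendsto _).comp (hψ (hs.toLp _))
      have h4 : Tendsto (fun n => ‖∫ y, K (x, y) * ψ n y‖ₑ) atTop (𝓝 0) := by
        have := (continuous_enorm.tendsto _).comp h3
        simp only [map_zero, enorm_zero] at this
        refine this.congr fun n => ?_
        simp only [Function.comp_apply, e1]
      have := ((ENNReal.continuous_rpow_const (y := (2 : ℝ))).tendsto _).comp h4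
      rw [ENNReal.zero_rpow_of_pos (by norm_num)] at this
      exact this
  rw [tendsto_zero_iff_norm_tendsto_zero]
  have hnorm : ∀ n, ‖kernelOp K hK (ψ n)‖ =
      ((∫⁻ x, ‖∫ y, K (x, y) * ψ n y‖ₑ ^ (2 : ℝ)) ^ (1 / 2 : ℝ)).toReal := by
    intro n
    rw [Lp.norm_def, eLpNorm_congr_ae (kernelOp_apply K hK (ψ n)),
      eLpNorm_eq_lintegral_rpow_enorm_toReal (by norm_num) (by norm_num)]
    simp
  simp only [hnorm]
  have h1 := ((ENNReal.continuous_rpow_const (y := (1 / 2 : ℝ))).tendsto _).comp hint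
  have h2 : ((0 : ℝ≥0∞) ^ (1 / 2 : ℝ)) = 0 := by norm_num
  rw [h2] at h1
  exact (ENNReal.tendsto_toReal ENNReal.zero_ne_top).comp h1

/-- Hilbert–Schmidt operators are compact. -/
theorem isCompactOperator_kernelOp (K : E3 × E3 → ℂ) (hK : MemLp K 2 (volume.prod volume)) :
    IsCompactOperator (kernelOp K hK) := by
  rw [isCompactOperator_iff_exists_mem_nhds_image_subset_compact]
  -- The image of the closed ball is itself compact, because weak limits stay in the ball.
  refine ⟨Metric.closedBall 0 1, Metric.closedBall_mem_nhds _ one_pos,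
    kernelOp K hK '' Metric.closedBall 0 1, IsSeqCompact.isCompact ?_, subset_rfl⟩
  intro y hy
  choose x hx hxy using hy
  have hx1 : ∀ n, ‖x n‖ ≤ 1 := fun n => by simpa using hx n
  -- Needed for the instance making `L²` separable.
  have : Fact ((2 : ℝ≥0∞) ≠ ∞) := ⟨by norm_num⟩
  obtain ⟨a, ha, σ, hσ, hlim⟩ := exists_subseq_tendsto_inner hx1
  refine ⟨kernelOp K hK a, ⟨a, by simpa using ha, rfl⟩, σ, hσ, ?_⟩
  have h := tendsto_kernelOp_of_weakly_null K hK (ψ := fun n => x (σ n) - a) (M := 2)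
    (fun n => (norm_sub_le _ _).trans (by linarith [hx1 (σ n)]))
    (fun y => by simpa [inner_sub_left] using (hlim y).sub_const (inner ℂ a y))
  have h2 := h.add_const (kernelOp K hK a)
  simp only [map_sub, sub_add_cancel, zero_add] at h2
  exact h2.congr fun n => hxy (σ n)

theorem isCompactOperator_sandwich {f g : E3 → ℝ} (hf : MemLp f 3 volume) (hg : MemLp g 3 volume) :
    IsCompactOperator (sandwich f g hf hg) :=
  isCompactOperator_kernelOp _ (coulombKernel_memLp hf hg)

end PointInteraction

/-! ### Positivity of `f p⁻² f` through a Gaussian factorization of the Coulomb kernel. -/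

/-- A kernel of the form `∫ h(ω, x) h(ω, y) dω` defines a nonnegative quadratic form. -/
theorem exists_nonneg_integral_eq_of_factorization {α Ω : Type*} [MeasurableSpace α]
    [MeasurableSpace Ω] {ν : Measure α} {μ : Measure Ω} [SFinite ν] [SFinite μ]
    {h : Ω → α → ℝ} (hh : Measurable (Function.uncurry h)) (h0 : ∀ ω x, 0 ≤ h ω x)
    {k : α × α → ℝ}
    (hk : ∀ᵐ p ∂ν.prod ν, Integrable (fun ω => h ω p.1 * h ω p.2) μ ∧
      ∫ ω, h ω p.1 * h ω p.2 ∂μ = k p)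
    {f : α → ℂ} (hf : AEStronglyMeasurable f ν)
    (hint : Integrable (fun p : α × α => (starRingEnd ℂ) (f p.1) * (k p : ℂ) * f p.2)
      (ν.prod ν)) :
    ∃ r : ℝ, 0 ≤ r ∧
      ∫ p, (starRingEnd ℂ) (f p.1) * (k p : ℂ) * f p.2 ∂(ν.prod ν) = (r : ℂ) := by
  let G : α × α → Ω → ℂ := fun p ω =>
    (starRingEnd ℂ) (f p.1) * ((h ω p.1 * h ω p.2 : ℝ) : ℂ) * f p.2
  have hfc : AEStronglyMeasurable (fun x => (starRingEnd ℂ) (f x)) ν :=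
    Complex.continuous_conj.comp_aestronglyMeasurable hf
  have hGm : AEStronglyMeasurable (Function.uncurry G) ((ν.prod ν).prod μ) := by
    have m1 : Measurable (fun q : (α × α) × Ω => h q.2 q.1.1) :=
      hh.comp (measurable_snd.prodMk measurable_fst.fst)
    have m2 : Measurable (fun q : (α × α) × Ω => h q.2 q.1.2) :=
      hh.comp (measurable_snd.prodMk measurable_fst.snd)
    exact (hfc.comp_fst.comp_fst.mul
      (Complex.measurable_ofReal.comp (m1.mul m2)).aestronglyMeasurable).mul hf.comp_snd.comp_fst
  have hGint : Integrable (Function.uncurry G) ((ν.prod ν).prod μ) := by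
    rw [integrable_prod_iff hGm]
    constructor
    · filter_upwards [hk] with p hp
      have h1 : Integrable (fun ω => ((h ω p.1 * h ω p.2 : ℝ) : ℂ)) μ := hp.1.ofReal
      exact (h1.const_mul ((starRingEnd ℂ) (f p.1))).mul_const (f p.2)
    -- Since `h ≥ 0`, integrating `‖G‖` over `ω` reproduces the norm of the integrand in `hint`.
    · refine hint.norm.congr ?_
      filter_upwards [hk] with p hp
      have e1 : ∀ ω, ‖G p ω‖ = ‖f p.1‖ * (h ω p.1 * h ω p.2) * ‖f p.2‖ := fun ω => by
        simp only [G, norm_mul, RCLike.norm_conj, Complex.norm_real, Real.norm_eq_abs,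
          abs_of_nonneg (h0 _ _)]
      have e2 : 0 ≤ k p := by
        rw [← hp.2]; exact integral_nonneg fun ω => mul_nonneg (h0 _ _) (h0 _ _)
      simp only [Function.uncurry_apply_pair, e1]
      rw [integral_mul_const, integral_const_mul, hp.2]
      simp [abs_of_nonneg e2]
  -- After Fubini, the integrand at fixed `ω` is the product of an integral and its conjugate.
  refine ⟨∫ ω, ‖∫ x, (h ω x : ℂ) * f x ∂ν‖ ^ 2 ∂μ, integral_nonneg fun ω => by positivity, ?_⟩
  have e1 : ∫ p, (starRingEnd ℂ) (f p.1) * (k p : ℂ) * f p.2 ∂(ν.prod ν) =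
      ∫ p, ∫ ω, G p ω ∂μ ∂(ν.prod ν) := by
    refine integral_congr_ae ?_
    filter_upwards [hk] with p hp
    simp only [G]
    rw [integral_mul_const, integral_const_mul, integral_complex_ofReal, hp.2]
  rw [e1, integral_integral_swap hGint, ← integral_complex_ofReal]
  refine integral_congr_ae (Eventually.of_forall fun ω => ?_)
  have e2 : ∀ p : α × α, G p ω =
      (starRingEnd ℂ) ((h ω p.1 : ℂ) * f p.1) * ((h ω p.2 : ℂ) * f p.2) := fun p => by
    simp only [G, map_mul, Complex.conj_ofReal, Complex.ofReal_mul]; ring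
  simp only [e2]
  rw [integral_prod_mul (fun x => (starRingEnd ℂ) ((h ω x : ℂ) * f x)) (fun x => (h ω x : ℂ) * f x),
    integral_conj, Complex.conj_mul']
  simp

namespace PointInteraction

/-- The Gaussians `s^{3/2} exp(-2 s² |x - w|²)`, whose products integrate to a multiple of the Coulomb
kernel. -/
noncomputable def gaussianFactor (ω : ℝ × E3) (x : E3) : ℝ :=
  √(ω.1 ^ 3) * Real.exp (-(2 * ω.1 ^ 2) * ‖ω.2 - x‖ ^ 2)

lemma measurable_gaussianFactor : Measurable (Function.uncurry gaussianFactor) := by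
  unfold gaussianFactor Function.uncurry
  fun_prop

lemma gaussianFactor_nonneg (ω : ℝ × E3) (x : E3) : 0 ≤ gaussianFactor ω x := by
  unfold gaussianFactor; positivity

/-- The parallelogram law separates the distance of `w` to the midpoint from `‖x - y‖`. -/
lemma gaussianFactor_mul {s : ℝ} (hs : 0 < s) (w x y : E3) :
    gaussianFactor (s, w) x * gaussianFactor (s, w) y =
      s ^ 3 * Real.exp (-‖x - y‖ ^ 2 * s ^ 2) *
        Real.exp (-(4 * s ^ 2) * ‖w - (2⁻¹ : ℝ) • (x + y)‖ ^ 2) := by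
  have hpar : ‖w - x‖ ^ 2 + ‖w - y‖ ^ 2 =
      2 * ‖w - (2⁻¹ : ℝ) • (x + y)‖ ^ 2 + 2⁻¹ * ‖x - y‖ ^ 2 := by
    have h1 := parallelogram_law_with_norm ℝ (w - x) (w - y)
    have h2 : (w - x) + (w - y) = (2 : ℝ) • (w - (2⁻¹ : ℝ) • (x + y)) := by
      rw [smul_sub, smul_smul, two_smul]; norm_num; abel
    have h3 : (w - x) - (w - y) = -(x - y) := by abel
    rw [h2, h3, norm_neg, norm_smul, Real.norm_eq_abs, abs_of_pos two_pos] at h1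
    linarith
  have hsq : √(s ^ 3) * √(s ^ 3) = s ^ 3 := Real.mul_self_sqrt (by positivity)
  simp only [gaussianFactor]
  rw [mul_mul_mul_comm, hsq, ← Real.exp_add, mul_assoc, ← Real.exp_add]
  congr 2
  linear_combination (-(2 * s ^ 2)) * hpar

lemma integrable_exp_neg_mul_sq_norm_sub {b : ℝ} (hb : 0 < b) (z : E3) :
    Integrable (fun w : E3 => Real.exp (-b * ‖w - z‖ ^ 2)) := by
  have h := GaussianFourier.integral_rexp_neg_mul_sq_norm (V := E3) hb
  have hi : Integrable (fun w : E3 => Real.exp (-b * ‖w‖ ^ 2)) := by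
    -- A non-integrable function has integral 0 by convention, contradicting the positive Gaussian
    -- value.
    by_contra hn
    rw [integral_undef hn] at h
    have : 0 < (Real.pi / b) ^ (Module.finrank ℝ E3 / 2 : ℝ) := by positivity
    linarith
  exact hi.comp_sub_right z

/-- The weight `s³` cancels the scaling of the three-dimensional Gaussian, leaving a value
independent of `s`. -/
lemma integral_exp_neg_four_mul_sq {s : ℝ} (hs : 0 < s) (z : E3) :
    s ^ 3 * ∫ w : E3, Real.exp (-(4 * s ^ 2) * ‖w - z‖ ^ 2) = (Real.pi / 4) ^ (3 / 2 : ℝ) := by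
  rw [integral_sub_right_eq_self (fun w : E3 => Real.exp (-(4 * s ^ 2) * ‖w‖ ^ 2)) z,
    GaussianFourier.integral_rexp_neg_mul_sq_norm (V := E3) (by positivity)]
  have hd : (Module.finrank ℝ E3 : ℝ) = 3 := by simp
  have h1 : Real.pi / (4 * s ^ 2) = Real.pi / 4 * (s ^ 2)⁻¹ := by field_simp
  have h2 : ((s ^ 2)⁻¹) ^ (3 / 2 : ℝ) = (s ^ 3)⁻¹ := by
    rw [Real.inv_rpow (by positivity), ← Real.rpow_natCast s 2, ← Real.rpow_mul hs.le,
      ← Real.rpow_natCast s 3]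
    norm_num
  rw [hd, h1, Real.mul_rpow (by positivity) (by positivity), h2]
  field_simp

/-- `∫ h(ω, x) h(ω, y) dω` is a positive multiple of `1 / |x - y|`. -/
lemma gaussianFactor_integral {x y : E3} (hxy : x ≠ y) :
    Integrable (fun ω => gaussianFactor ω x * gaussianFactor ω y)
        ((volume.restrict (Set.Ioi (0 : ℝ))).prod volume) ∧
      ∫ ω, gaussianFactor ω x * gaussianFactor ω y
          ∂((volume.restrict (Set.Ioi (0 : ℝ))).prod volume) =
        (Real.pi / 4) ^ (3 / 2 : ℝ) * √Real.pi / 2 * (1 / ‖x - y‖) := by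
  have hr : 0 < ‖x - y‖ := norm_pos_iff.2 (sub_ne_zero.2 hxy)
  have hm : Measurable (fun ω => gaussianFactor ω x * gaussianFactor ω y) :=
    (measurable_gaussianFactor.comp (measurable_id.prodMk measurable_const)).mul
      (measurable_gaussianFactor.comp (measurable_id.prodMk measurable_const))
  -- Once `w` is integrated out, a half-line Gaussian in `s` remains, and its integral is
  -- proportional to `1/‖x - y‖`.
  have hin : ∀ s : ℝ, 0 < s → ∫ w : E3, gaussianFactor (s, w) x * gaussianFactor (s, w) y =
      (Real.pi / 4) ^ (3 / 2 : ℝ) * Real.exp (-‖x - y‖ ^ 2 * s ^ 2) := fun s hs => by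
    simp only [gaussianFactor_mul hs]
    rw [integral_const_mul, ← integral_exp_neg_four_mul_sq hs ((2⁻¹ : ℝ) • (x + y))]
    ring
  have hpos : ∀ᵐ s : ℝ ∂volume.restrict (Set.Ioi (0 : ℝ)), 0 < s :=
    (ae_restrict_iff' measurableSet_Ioi).2 (Eventually.of_forall fun s hs => hs)
  have hgi : Integrable (fun s : ℝ => (Real.pi / 4) ^ (3 / 2 : ℝ) *
      Real.exp (-‖x - y‖ ^ 2 * s ^ 2)) (volume.restrict (Set.Ioi (0 : ℝ))) :=
    ((integrable_exp_neg_mul_sq (b := ‖x - y‖ ^ 2) (by positivity)).restrict).const_mul _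
  have hI : Integrable (fun ω => gaussianFactor ω x * gaussianFactor ω y)
      ((volume.restrict (Set.Ioi (0 : ℝ))).prod volume) := by
    rw [integrable_prod_iff hm.aestronglyMeasurable]
    constructor
    · filter_upwards [hpos] with s hs
      simp only [gaussianFactor_mul hs]
      exact (integrable_exp_neg_mul_sq_norm_sub (by positivity) _).const_mul _
    · refine hgi.congr ?_
      filter_upwards [hpos] with s hs
      rw [← hin s hs]
      refine integral_congr_ae (Eventually.of_forall fun w => ?_)
      simp only [Real.norm_eq_abs]
      rw [abs_of_nonneg (mul_nonneg (gaussianFactor_nonneg _ _) (gaussianFactor_nonneg _ _))]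
  refine ⟨hI, ?_⟩
  rw [integral_prod _ hI]
  have : ∫ s in Set.Ioi (0 : ℝ), ∫ w : E3, gaussianFactor (s, w) x * gaussianFactor (s, w) y =
      ∫ s in Set.Ioi (0 : ℝ), (Real.pi / 4) ^ (3 / 2 : ℝ) * Real.exp (-‖x - y‖ ^ 2 * s ^ 2) :=
    setIntegral_congr_fun measurableSet_Ioi fun s hs => hin s hs
  rw [this, integral_const_mul, integral_gaussian_Ioi, Real.sqrt_div Real.pi_pos.le,
    Real.sqrt_sq hr.le]
  ring

/-- The Gaussian factorization fails on the diagonal, where the product is not integrable; this null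
set has to be discarded. -/
lemma ae_fst_ne_snd : ∀ᵐ p : E3 × E3 ∂(volume.prod volume), p.1 ≠ p.2 := by
  refine (Measure.ae_prod_iff_ae_ae
    (measurableSet_eq_fun measurable_fst measurable_snd).compl).2 (Eventually.of_forall fun x => ?_)
  filter_upwards [measure_eq_zero_iff_ae_notMem.1 (measure_singleton (μ := (volume : Measure E3)) x)]
    with y hy
  exact fun h => hy h.symm

/-- The operator `f p⁻² f` is positive. -/
theorem sandwich_isPositive {f : E3 → ℝ} (hf : MemLp f 3 volume) :
    (sandwich f f hf hf).IsPositive := by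
  rw [ContinuousLinearMap.isPositive_iff_complex]
  intro ψ
  have hK := coulombKernel_memLp hf hf
  set A : ℝ := (Real.pi / 4) ^ (3 / 2 : ℝ) * √Real.pi / 2 with hA
  have hA0 : 0 < A := by positivity
  have hψ := Lp.aestronglyMeasurable ψ
  have hψ2 : Integrable (fun x => ‖ψ x‖ ^ 2) := (Lp.memLp ψ).integrable_norm_pow (by norm_num)
  have hint : Integrable (fun p : E3 × E3 =>
      (starRingEnd ℂ) (ψ p.1) * (coulombKernel f f p * ψ p.2)) (volume.prod volume) := by
    have h1 := (memLp_two_iff_integrable_sq_norm hK.1).1 hK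
    refine (h1.add (hψ2.mul_prod hψ2)).mono' ?_ (Eventually.of_forall fun p => ?_)
    · exact (Complex.continuous_conj.comp_aestronglyMeasurable hψ).comp_fst.mul
        (hK.1.mul hψ.comp_snd)
    · simp only [norm_mul, RCLike.norm_conj, Pi.add_apply]
      nlinarith [sq_nonneg (‖coulombKernel f f p‖ - ‖ψ p.1‖ * ‖ψ p.2‖),
        sq_nonneg ‖coulombKernel f f p‖, sq_nonneg (‖ψ p.1‖ * ‖ψ p.2‖)]
  have e1 : inner ℂ ψ (sandwich f f hf hf ψ) = ∫ p : E3 × E3,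
      (starRingEnd ℂ) (ψ p.1) * (coulombKernel f f p * ψ p.2) ∂(volume.prod volume) := by
    rw [L2.inner_def, integral_prod _ hint]
    refine integral_congr_ae ?_
    filter_upwards [kernelOp_apply (coulombKernel f f) hK ψ] with x hx
    rw [sandwich, hx, integral_const_mul]
    simp [mul_comm]
  -- Absorbs `f` into `ψ` and adjusts the constant from `1/(4π)` to `A`, the one produced by the
  -- Gaussians.
  have hre : ∀ p : E3 × E3, (starRingEnd ℂ) (ψ p.1) * (coulombKernel f f p * ψ p.2) =
      ((4 * Real.pi * A)⁻¹ : ℝ) * ((starRingEnd ℂ) ((f p.1 : ℂ) * ψ p.1) *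
        ((A * (1 / ‖p.1 - p.2‖) : ℝ) : ℂ) * ((f p.2 : ℂ) * ψ p.2)) := by
    intro p
    have h1 : f p.1 * (1 / (4 * Real.pi * ‖p.1 - p.2‖)) * f p.2 =
        (4 * Real.pi * A)⁻¹ * (f p.1 * (A * (1 / ‖p.1 - p.2‖)) * f p.2) := by
      have := Real.pi_pos.ne'
      field_simp
    rw [coulombKernel, h1]
    push_cast
    simp only [map_mul, Complex.conj_ofReal]
    ring
  have hfm : AEStronglyMeasurable (fun x => (f x : ℂ) * ψ x) volume :=
    (Complex.continuous_ofReal.comp_aestronglyMeasurable hf.1).mul hψ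
  have hint2 : Integrable (fun p : E3 × E3 => (starRingEnd ℂ) ((f p.1 : ℂ) * ψ p.1) *
        ((A * (1 / ‖p.1 - p.2‖) : ℝ) : ℂ) * ((f p.2 : ℂ) * ψ p.2)) (volume.prod volume) := by
    have hne : (((4 * Real.pi * A)⁻¹ : ℝ) : ℂ) ≠ 0 := by
      exact_mod_cast (inv_pos.2 (by positivity)).ne'
    simp only [hre] at hint
    exact (integrable_const_mul_iff (isUnit_iff_ne_zero.2 hne) _).1 hint
  obtain ⟨r, hr0, hr⟩ := exists_nonneg_integral_eq_of_factorization
    (μ := (volume.restrict (Set.Ioi (0 : ℝ))).prod (volume : Measure E3))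
    (k := fun p : E3 × E3 => A * (1 / ‖p.1 - p.2‖))
    measurable_gaussianFactor gaussianFactor_nonneg
    (by filter_upwards [ae_fst_ne_snd] with p hp using gaussianFactor_integral hp) hfm hint2
  have e2 : inner ℂ (sandwich f f hf hf ψ) ψ = (((4 * Real.pi * A)⁻¹ * r : ℝ) : ℂ) := by
    rw [← inner_conj_symm, e1]
    simp only [hre]
    rw [integral_const_mul, hr, ← Complex.ofReal_mul, Complex.conj_ofReal]
  rw [e2]
  have : 0 ≤ (4 * Real.pi * A)⁻¹ * r := by positivity
  simpa using this

end PointInteraction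

/-! ### The factorizations `B = JX` and `X⁻ = QXQ`. -/

namespace PointInteraction

namespace Potential

lemma Jmul_coeFn (V : Potential) (φ : L2) : V.Jmul φ =ᵐ[volume] fun x => (V.J x : ℂ) * φ x :=
  (V.J_mul_memLp φ).coeFn_toLp

lemma J_mul_J (V : Potential) (x : E3) : (V.J x : ℂ) * (V.J x : ℂ) = 1 := by
  unfold J sgn; split_ifs <;> simp

lemma Jmul_Jmul (V : Potential) (φ : L2) : V.Jmul (V.Jmul φ) = φ := by
  refine Lp.ext ?_
  filter_upwards [V.Jmul_coeFn (V.Jmul φ), V.Jmul_coeFn φ] with x h1 h2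
  rw [h1, h2, ← mul_assoc, J_mul_J, one_mul]

lemma norm_Jmul (V : Potential) (φ : L2) : ‖V.Jmul φ‖ = ‖φ‖ := by
  rw [Lp.norm_def, Lp.norm_def]
  refine congrArg _ (eLpNorm_congr_norm_ae ?_)
  filter_upwards [V.Jmul_coeFn φ] with x hx
  rw [hx]
  simp [J, norm_sgn, -Real.norm_eq_abs]

/-- Multiplication by `J` as a bounded operator. -/
noncomputable def Jop (V : Potential) : L2 →L[ℂ] L2 :=
  LinearMap.mkContinuous
    { toFun := V.Jmul
      map_add' := fun φ ψ => by
        refine Lp.ext ?_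
        filter_upwards [V.Jmul_coeFn (φ + ψ), V.Jmul_coeFn φ, V.Jmul_coeFn ψ, Lp.coeFn_add φ ψ,
          Lp.coeFn_add (V.Jmul φ) (V.Jmul ψ)] with x h1 h2 h3 h4 h5
        rw [h1, h4, h5, Pi.add_apply, Pi.add_apply, h2, h3, mul_add]
      map_smul' := fun c φ => by
        refine Lp.ext ?_
        filter_upwards [V.Jmul_coeFn (c • φ), V.Jmul_coeFn φ, Lp.coeFn_smul c φ,
          Lp.coeFn_smul c (V.Jmul φ)] with x h1 h2 h3 h4
        rw [RingHom.id_apply, h1, h3, h4, Pi.smul_apply, Pi.smul_apply, h2, smul_eq_mul,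
          smul_eq_mul, mul_left_comm] }
    1 (fun φ => by rw [one_mul]; exact (V.norm_Jmul φ).le)

lemma isSelfAdjoint_Jop (V : Potential) : IsSelfAdjoint V.Jop := by
  rw [ContinuousLinearMap.isSelfAdjoint_iff_isSymmetric]
  intro φ ψ
  change inner ℂ (V.Jmul φ) ψ = inner ℂ φ (V.Jmul ψ)
  rw [L2.inner_def, L2.inner_def]
  refine integral_congr_ae ?_
  filter_upwards [V.Jmul_coeFn φ, V.Jmul_coeFn ψ] with x h1 h2
  rw [h1, h2]
  simp only [RCLike.inner_apply, map_mul, Complex.conj_ofReal]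
  ring

/-- The projection onto the functions supported in `{V < 0}`. -/
noncomputable def negProj (V : Potential) : L2 →L[ℂ] L2 := (2⁻¹ : ℂ) • (1 - V.Jop)

lemma negProj_apply (V : Potential) (φ : L2) : V.negProj φ = (2⁻¹ : ℂ) • (φ - V.Jmul φ) := rfl

lemma sub_two_smul_negProj (V : Potential) (φ : L2) :
    φ - (2 : ℂ) • V.negProj φ = V.Jmul φ := by
  rw [negProj_apply, smul_smul]; simp

lemma isSelfAdjoint_negProj (V : Potential) : IsSelfAdjoint V.negProj := by
  refine IsSelfAdjoint.smul ?_ ((IsSelfAdjoint.one _).sub V.isSelfAdjoint_Jop)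
  simp [isSelfAdjoint_iff]

lemma negProj_mul_negProj (V : Potential) : V.negProj * V.negProj = V.negProj := by
  have hJ : V.Jop * V.Jop = 1 := by
    ext1 φ
    exact V.Jmul_Jmul φ
  rw [negProj, smul_mul_smul_comm, mul_sub, sub_mul, sub_mul, hJ]
  simp only [one_mul, mul_one]
  rw [show (1 - V.Jop - (V.Jop - 1) : L2 →L[ℂ] L2) = (2 : ℂ) • (1 - V.Jop) by
    rw [two_smul]; abel, smul_smul]
  norm_num

lemma negProj_coeFn (V : Potential) (φ : L2) :
    V.negProj φ =ᵐ[volume] fun x => ((if V x < 0 then 1 else 0 : ℝ) : ℂ) * φ x := by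
  rw [negProj_apply]
  filter_upwards [Lp.coeFn_smul (2⁻¹ : ℂ) (φ - V.Jmul φ), Lp.coeFn_sub φ (V.Jmul φ),
    V.Jmul_coeFn φ] with x h1 h2 h3
  rw [h1, Pi.smul_apply, h2, Pi.sub_apply, h3, smul_eq_mul, J, sgn]
  by_cases h : 0 ≤ V x
  · simp [h, not_lt.2 h]
  · simp [h, not_le.1 h]
    ring

/-- The operator `X = |V|^{1/2} p⁻² |V|^{1/2}`. -/
noncomputable def absOp (V : Potential) : L2 →L[ℂ] L2 :=
  sandwich V.sqrtAbs V.sqrtAbs V.sqrtAbs_memLp V.sqrtAbs_memLp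

/-- The sign in `V^{1/2}` depends only on the outer variable and comes out of the integral. -/
lemma B_apply (V : Potential) (φ : L2) : V.B φ = V.Jmul (V.absOp φ) := by
  refine Lp.ext ?_
  filter_upwards [kernelOp_apply (coulombKernel V.sqrtSgn V.sqrtAbs)
    (coulombKernel_memLp V.sqrtSgn_memLp V.sqrtAbs_memLp) φ, V.Jmul_coeFn (V.absOp φ),
    kernelOp_apply (coulombKernel V.sqrtAbs V.sqrtAbs)
      (coulombKernel_memLp V.sqrtAbs_memLp V.sqrtAbs_memLp) φ] with x h1 h2 h3
  rw [B, sandwich, h1, h2, absOp, sandwich, h3, ← integral_const_mul]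
  refine integral_congr_ae (Eventually.of_forall fun y => ?_)
  simp only [coulombKernel, sqrtSgn, sqrtAbs]
  push_cast
  ring

lemma neg_sqrtAbs (V : Potential) (x : E3) :
    V.neg.sqrtAbs x = (if V x < 0 then 1 else 0) * V.sqrtAbs x := by
  have h0 : V.neg x = max (-V x) 0 := rfl
  simp only [sqrtAbs]
  split_ifs with h
  · rw [h0, max_eq_left (by linarith), abs_neg, one_mul]
  · rw [h0, max_eq_right (by linarith)]; simp

/-- `(V⁻)^{1/2}` is `|V|^{1/2}` cut off to `{V < 0}`, so each outer factor contributes one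
projection. -/
lemma Xneg_eq (V : Potential) : V.Xneg = V.negProj * V.absOp * V.negProj := by
  ext1 φ
  change V.Xneg φ = V.negProj (V.absOp (V.negProj φ))
  refine Lp.ext ?_
  filter_upwards [kernelOp_apply (coulombKernel V.neg.sqrtAbs V.neg.sqrtAbs)
    (coulombKernel_memLp V.neg.sqrtAbs_memLp V.neg.sqrtAbs_memLp) φ,
    V.negProj_coeFn (V.absOp (V.negProj φ)),
    kernelOp_apply (coulombKernel V.sqrtAbs V.sqrtAbs)
      (coulombKernel_memLp V.sqrtAbs_memLp V.sqrtAbs_memLp) (V.negProj φ)] with x h1 h2 h3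
  rw [Xneg, sandwich, h1, h2, absOp, sandwich, h3, ← integral_const_mul]
  refine integral_congr_ae ?_
  filter_upwards [V.negProj_coeFn φ] with y hy
  rw [hy]
  simp only [coulombKernel, neg_sqrtAbs]
  push_cast
  ring

end Potential

/-! ### From the spectral assumptions to the uniform bound. -/

/-- The form of `X⁻` is controlled by the spectral gap of `1 - X⁻`. -/
theorem re_inner_Xneg_le {V : Potential} {e' c : ℝ} (hc1 : c ≤ 1) (he' : -c < e')
    (hlow : IsSimpleLowestEigenvalue (1 - V.Xneg) e')
    (hgap : OtherEigenvaluesGapped (1 - V.Xneg) e' c) :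
    ∃ u : L2, ‖u‖ = 1 ∧ ∀ v : L2, (inner ℂ (V.Xneg v) v).re ≤
      (1 - c) * ‖v‖ ^ 2 + (c - e') * ‖inner ℂ u v‖ ^ 2 := by
  obtain ⟨⟨w, hw⟩, hw0, hspan⟩ := finrank_eq_one_iff'.1 hlow.simple
  have hw0' : w ≠ 0 := fun h => hw0 (Subtype.ext h)
  have hwn : (‖w‖ : ℂ) ≠ 0 := by simpa using hw0'
  set u : L2 := (‖w‖ : ℂ)⁻¹ • w with hu
  have hu1 : ‖u‖ = 1 := by
    rw [hu, norm_smul, norm_inv, Complex.norm_real, norm_norm,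
      inv_mul_cancel₀ (norm_ne_zero_iff.2 hw0')]
  have hwu : w = (‖w‖ : ℂ) • u := by rw [hu, smul_smul, mul_inv_cancel₀ hwn, one_smul]
  have hXw : V.Xneg w = ((1 - e' : ℝ) : ℂ) • w := by
    have h1 : w - V.Xneg w = (e' : ℂ) • w := Module.End.mem_eigenspace_iff.1 hw
    push_cast
    rw [sub_smul, one_smul, ← h1]; abel
  have hXu : V.Xneg u = ((1 - e' : ℝ) : ℂ) • u := by
    rw [hu, map_smul, hXw, smul_comm]
  have hsa : IsSelfAdjoint V.Xneg := (sandwich_isPositive V.neg.sqrtAbs_memLp).isSelfAdjoint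
  have hcomp : IsCompactOperator V.Xneg := isCompactOperator_sandwich _ _
  refine ⟨u, hu1, fun v => ?_⟩
  have key := hcomp.re_inner_le hsa hu1 hXu (sub_nonneg.2 hc1) (fun l v hv hor hXv => ?_) v
  · rwa [show (1 - e') - (1 - c) = c - e' by ring] at key
  have hmem : v ∈ Module.End.eigenspace ((1 - V.Xneg : L2 →L[ℂ] L2) : L2 →ₗ[ℂ] L2)
      ((1 - l : ℝ) : ℂ) := by
    rw [Module.End.mem_eigenspace_iff]
    change v - V.Xneg v = _
    rw [hXv]
    push_cast
    rw [sub_smul, one_smul]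
  have hev : Module.End.HasEigenvalue ((1 - V.Xneg : L2 →L[ℂ] L2) : L2 →ₗ[ℂ] L2)
      ((1 - l : ℝ) : ℂ) := Module.End.hasEigenvalue_of_hasEigenvector ⟨hmem, hv⟩
  -- The eigenspace at `e'` is spanned by `u`, and `v` is nonzero and orthogonal to `u`.
  have hne : 1 - l ≠ e' := by
    intro h
    rw [h] at hmem
    obtain ⟨k, hk⟩ := hspan ⟨v, hmem⟩
    have hk' : k • w = v := congrArg Subtype.val hk
    rw [← hk', hwu, inner_smul_right, inner_smul_right, inner_self_eq_norm_sq_to_K, hu1] at hor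
    have hk0 : k = 0 := by simpa [hw0'] using hor
    exact hv (by rw [← hk', hk0, zero_smul])
  have h1 := hgap _ hev hne
  have h2 := hlow.lowest _ hev
  -- The alternative `1 - l ≤ -c` is excluded by `-c < e' ≤ 1 - l`.
  rcases le_abs.1 h1 with h3 | h3 <;> linarith

/-- The bound for a single potential. -/
theorem Potential.reduced_resolvent_bound {V : Potential} {e e' c : ℝ} (hc : 0 < c) (hc1 : c ≤ 1)
    (he : |e| ≤ c ^ 2 / 64) (he' : |e'| ≤ c ^ 2 / 64) (he0 : e ≠ 0)
    (hlow : IsSimpleLowestEigenvalue (1 - V.Xneg) e')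
    (hgap : OtherEigenvaluesGapped (1 - V.Xneg) e' c) {φ : L2}
    (hφ : Module.End.HasEigenvector ((1 + V.B : L2 →L[ℂ] L2) : L2 →ₗ[ℂ] L2) (e : ℂ) φ) :
    IsUnit (1 + V.B) ∧ inner ℂ (V.Jmul φ) φ ≠ 0 ∧
      ‖Ring.inverse (1 + V.B) * (1 - V.P φ)‖ ≤ 12 / c ∧
      Ring.inverse (1 + V.B) * V.P φ = ((e : ℂ)⁻¹) • V.P φ := by
  have hcc : c ^ 2 ≤ c := by nlinarith
  obtain ⟨u, hu, hT⟩ := re_inner_Xneg_le hc1 (by linarith [(abs_le.1 he').1]) hlow hgap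
  rw [V.Xneg_eq] at hT
  refine _root_.reduced_resolvent_bound (A := 1 + V.B) (sandwich_isPositive V.sqrtAbs_memLp)
    V.isSelfAdjoint_negProj V.negProj_mul_negProj (fun v => ?_) ?_ hu hc hc1 he he' hT he0 hφ.2
    hφ.apply_eq_smul (V.sub_two_smul_negProj φ).symm
  · rw [V.sub_two_smul_negProj]
    exact congrArg (v + ·) (V.B_apply v)
  · rw [add_sub_cancel_left]
    exact isCompactOperator_sandwich _ _

end PointInteraction

theorem corollary1 (V : ℝ → PointInteraction.Potential) (e eNeg : ℝ → ℝ)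
    (hV : PointInteraction.Assumptions V e eNeg) :
    ∃ C : ℝ, ∀ᶠ ℓ in 𝓝[>] (0 : ℝ), IsUnit (1 + (V ℓ).B) ∧
      ∀ φ : PointInteraction.L2,
        Module.End.HasEigenvector
          ((1 + (V ℓ).B : PointInteraction.L2 →L[ℂ] PointInteraction.L2) :
            PointInteraction.L2 →ₗ[ℂ] PointInteraction.L2) (e ℓ : ℂ) φ →
        inner ℂ ((V ℓ).Jmul φ) φ ≠ 0 ∧
        ‖Ring.inverse (1 + (V ℓ).B) * (1 - (V ℓ).P φ)‖ ≤ C ∧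
        Ring.inverse (1 + (V ℓ).B) * (V ℓ).P φ = ((e ℓ : ℂ)⁻¹) • (V ℓ).P φ := by
  obtain ⟨c₀, hc₀, hgap⟩ := hV.gap
  -- Shrinking the gap preserves the hypothesis and secures `c ≤ 1`, which the abstract estimates
  -- require.
  set c : ℝ := min c₀ 1 with hc
  have hcpos : 0 < c := lt_min hc₀ one_pos
  have hc1 : c ≤ 1 := min_le_right _ _
  have hε : 0 < c ^ 2 / 64 := by positivity
  have small : ∀ {g : ℝ → ℝ}, Tendsto g (𝓝[>] 0) (𝓝 0) →
      ∀ᶠ ℓ in 𝓝[>] (0 : ℝ), |g ℓ| ≤ c ^ 2 / 64 := fun hg => by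
    filter_upwards [hg.eventually (Metric.closedBall_mem_nhds 0 hε)] with ℓ hℓ
    simpa using hℓ
  refine ⟨12 / c, ?_⟩
  filter_upwards [hgap, small hV.e_tendsto, small (hV.eNeg_isBigO.trans_tendsto hV.e_tendsto),
    self_mem_nhdsWithin] with ℓ hg he he' hℓ
  have hg' : PointInteraction.OtherEigenvaluesGapped (1 - (V ℓ).Xneg) (eNeg ℓ) c :=
    fun μ hμ hne => (min_le_left _ _).trans (hg.2 μ hμ hne)
  have main := fun φ hφ => PointInteraction.Potential.reduced_resolvent_bound (φ := φ) hcpos hc1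
    he he' (hV.e_ne_zero ℓ hℓ) (hV.lowest_neg ℓ hℓ) hg' hφ
  -- Invertibility does not mention `φ` but is derived from an eigenvector; simplicity of `e ℓ`
  -- supplies one.
  obtain ⟨⟨φ, hφ⟩, hφ0, -⟩ := finrank_eq_one_iff'.1 (hV.lowest ℓ hℓ).simple
  exact ⟨(main φ ⟨hφ, fun h => hφ0 (Subtype.ext h)⟩).1, fun φ hφ => (main φ hφ).2⟩
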